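/- Let $K\subset S^2\times\mathbb R$ be a smooth knot, that is, the image of an injective $C^1$ immersion of the circle (for instance a $C^\infty$ one) into $S^2\times\mathbb R$, the $3$-sphere with two points removed. Let $D\subset S^2$ be its image under the projection $S^2\times\mathbb R\to S^2$, and assume that this projection is regular: the projected closed curve is an immersion, at most two points of $K$ project to the same point of $S^2$, and the two branches of the curve at each double point are transversal. Let $V$ be the set of double points of $D$ and suppose that $V$ has exactly $n$ elements, $n>0$. An edge of $D$ is the closure of a connected component of $D\setminus V$. Two edges $I,J$ are neighbors if there is a connected component $Q$ of $S^2\setminus D$ whose boundary $\partial Q$ contains both $I$ and $J$. Two distinct edges $I,J$ are consecutive if $I\cup J$ is the image of a connected arc of the knot (possibly the whole knot, which happens only for $n=1$). Then among all metrics $d$ on the set of edges of $D$ that satisfy $d(I,J)=1$ for all consecutive edges $I,J$ there is a (pointwise) greatest one, $\rho$, and there are neighboring edges $I$ and $J$ of $D$ with $$\rho(I,J)\ \ge\ \frac{2n}{3}.$$ -/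

import Mathlib

namespace KnotProj

/-- Euclidean 3-space. -/
abbrev E3 := EuclideanSpace ℝ (Fin 3)

/-- The 2-sphere, realised as the unit sphere of Euclidean 3-space. -/
abbrev S2 := Metric.sphere (0 : E3) 1

/-- A (smooth) knot in `S² × ℝ`, i.e. in the 3-sphere with two points removed, which is where the
projection to `S²` lives: an injective immersion of the circle `ℝ / ℤ`. As a minimal smoothness
requirement the knot is continuously differentiable; `C^∞` knots are a special case. -/
structure SmoothKnot where
  /-- the parametrization by the circle `ℝ / ℤ` -/
  toFun : UnitAddCircle → S2 × ℝ
  /-- the knot has no self-intersection -/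
  injective : Function.Injective toFun
  /-- the parametrization is continuously differentiable -/
  smooth : ContDiff ℝ 1
    (fun t : ℝ => (((toFun (t : UnitAddCircle)).1 : E3), (toFun (t : UnitAddCircle)).2))
  /-- the parametrization has nowhere vanishing velocity -/
  immersion : ∀ t : ℝ, deriv
    (fun t : ℝ => (((toFun (t : UnitAddCircle)).1 : E3), (toFun (t : UnitAddCircle)).2)) t ≠ 0

namespace SmoothKnot

variable (K : SmoothKnot)

/-- The knot followed by the projection `S² × ℝ → S²`. -/
def proj (θ : UnitAddCircle) : S2 := (K.toFun θ).1

/-- The projected curve, as a 1-periodic curve in `ℝ³` with values in the unit sphere. -/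
def curve (t : ℝ) : E3 := (K.proj (t : UnitAddCircle) : E3)

/-- The projection `D ⊆ S²` of the knot. -/
def diagram : Set S2 := Set.range K.proj

/-- The double points: points of `S²` onto which two different points of the knot project. -/
def doublePoints : Set S2 :=
  {x | ∃ θ φ : UnitAddCircle, θ ≠ φ ∧ K.proj θ = x ∧ K.proj φ = x}

/-- The projection is regular: its only singularities are transversal double points. -/
structure IsRegular : Prop where
  /-- the projected curve is an immersion -/
  immersion : ∀ t : ℝ, deriv K.curve t ≠ 0
  /-- at most two points of the knot project onto the same point -/
  fiber_le_two : ∀ x : S2, {θ : UnitAddCircle | K.proj θ = x}.encard ≤ 2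
  /-- the two branches at a double point have different tangent lines -/
  transversal : ∀ s t : ℝ, (s : UnitAddCircle) ≠ (t : UnitAddCircle) →
    K.curve s = K.curve t → LinearIndependent ℝ ![deriv K.curve s, deriv K.curve t]

/-- The edges: closures of the connected components of the diagram minus its double points. -/
def edges : Set (Set S2) :=
  {I | ∃ x ∈ K.diagram \ K.doublePoints,
    I = closure (connectedComponentIn (K.diagram \ K.doublePoints) x)}

/-- Two edges are neighbors if both lie in the boundary of one component of `S² \ D`. -/
def Neighbors (I J : K.edges) : Prop :=
  ∃ x ∈ K.diagramᶜ, (I : Set S2) ⊆ frontier (connectedComponentIn K.diagramᶜ x) ∧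
    (J : Set S2) ⊆ frontier (connectedComponentIn K.diagramᶜ x)

/-- Two different edges are consecutive if their union is the image of a connected arc
of the knot. -/
def Consecutive (I J : K.edges) : Prop :=
  I ≠ J ∧ ∃ a b : ℝ, a ≤ b ∧
    (I : Set S2) ∪ (J : Set S2) = (fun t : ℝ => K.proj (t : UnitAddCircle)) '' Set.Icc a b

/-- The metrics on the set of edges in which consecutive edges have distance `1`. -/
def edgeMetrics : Set (K.edges → K.edges → ℝ) :=
  {d | (∀ I J, d I J = 0 ↔ I = J) ∧ (∀ I J, d I J = d J I) ∧
    (∀ I J L, d I L ≤ d I J + d J L) ∧ ∀ I J, K.Consecutive I J → d I J = 1}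

end SmoothKnot

end KnotProj

/-!
The double points cut the knot into `2 * n` arcs, whose images are the edges. Two edges are
consecutive exactly when their indices in `ZMod (2 * n)` are successive
(`CrossingCurve.index_succ_of_union_eq_image`), so the greatest metric is the distance `ρ` in the
cycle graph on `ZMod (2 * n)` (`isGreatest_natAbs_valMinAbs`).

For the inequality, send the edge with index `i` to the root of unity `exp (π * i * I / n)` and
suppose that any two edges with a common face are less than a third of the circle apart. By
transversality, at a double point each edge on one branch shares a face with each edge on the other
branch (`CrossingCurve.exists_corner`), so the edges ending at a double point are also pairwise less
than a third of the circle apart (`CrossingCurve.close_of_mem_edge`; this needs `2 ≤ n`, while for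
`n = 1` the corners already give a contradiction). Points of the circle that are pairwise less
than a third apart do not have the origin in their convex hull (`sum_mul_unitPt_mem_slitPlane`).
The sphere has an open cover indexed by the edges such that the indices of the sets through any
point are pairwise close: the set `CrossingCurve.U` of an edge consists of the open edge, the faces
it bounds, and small discs about its end points, with the discs about all other double points
removed. A partition of unity for this cover therefore combines the roots of unity into a
continuous function `F` from the sphere to `ℂ \ {0}`.

Since the knot projection misses some point of the sphere and the complement of that point is simply
connected, `F` has a continuous logarithm along the knot (`SmoothKnot.exists_continuous_log`). But
along the knot `F` stays close to the root of unity of the current edge, so its argument grows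
by `2 * π` in one period (`winding_contradiction`), which is absurd.

The topology of the knot projection enters through local models, obtained from the inverse
function theorem in a stereographic plane: near an ordinary point the curve is a coordinate axis
(`exists_isArcChart`), near a double point it is the union of the two axes
(`exists_isCrossChart`). They show that a face whose closure meets an open edge has the whole
edge in its boundary (`CrossingCurve.bd_of_mem_closure`).
-/

namespace KnotProj

open Set

/-! ### Points of the circle that are pairwise close -/

/-- The `2 * n`-th roots of unity with exponents `i` and `j` are less than a third of the full
circle apart: some representative of `i - j` modulo `2 * n` has absolute value less
than `2 * n / 3`. -/
def Close (n : ℕ) (i j : ℤ) : Prop := ∃ k : ℤ, 3 * |i - j - 2 * n * k| < 2 * n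

/-- The point of the unit circle with angle `π * x / n`. -/
noncomputable def unitPt (n : ℕ) (x : ℝ) : ℂ := Complex.exp ((Real.pi * x / n : ℝ) * Complex.I)

lemma unitPt_add (n : ℕ) (x y : ℝ) : unitPt n (x + y) = unitPt n x * unitPt n y := by
  rw [unitPt, unitPt, unitPt, ← Complex.exp_add]
  congr 1
  push_cast
  ring

lemma unitPt_re (n : ℕ) (x : ℝ) : (unitPt n x).re = Real.cos (Real.pi * x / n) := by
  rw [unitPt, Complex.exp_ofReal_mul_I_re]

lemma unitPt_period {n : ℕ} (hn : 0 < n) (x : ℝ) (k : ℤ) :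
    unitPt n (x + 2 * n * k) = unitPt n x := by
  rw [unitPt_add]
  have h : unitPt n (2 * n * k) = 1 := by
    rw [unitPt, Complex.exp_eq_one_iff]
    refine ⟨k, ?_⟩
    have : (n : ℂ) ≠ 0 := by exact_mod_cast hn.ne'
    push_cast
    field_simp
  rw [h, mul_one]

/-- A nonnegative combination of `2 * n`-th roots of unity that are pairwise less than a third of
the circle apart lies within a right angle of the midpoint of the shortest arc containing them.
Hence it is not opposite to any point at most half a step away from one of these roots. -/
lemma sum_mul_unitPt_mem_slitPlane {n : ℕ} (hn : 2 ≤ n) (w : ℤ → ℝ) (hw : ∀ i, 0 ≤ w i)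
    (hper : ∀ i k : ℤ, w (i + 2 * n * k) = w i)
    (hclose : ∀ i j, 0 < w i → 0 < w j → Close n i j)
    {i : ℤ} (hi : 0 < w i) {s : ℝ} (hs : |s| ≤ 1 / 2) :
    (∑ j ∈ Finset.Ico (0 : ℤ) (2 * n), (w j : ℂ) * unitPt n j) * unitPt n (-(i + s)) ∈
      Complex.slitPlane := by
  have hn0 : 0 < n := by omega
  have hnR : (2 : ℝ) ≤ n := by exact_mod_cast hn
  have hnZ : (0 : ℤ) < 2 * n := by exact_mod_cast (by omega : 0 < 2 * n)
  -- `c j` is the displacement from `i` to `j` along the short arc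
  have hc : ∀ j, ∃ c k : ℤ, 0 < w j → (c = j - i + 2 * n * k ∧ 3 * |c| < 2 * n) := by
    intro j
    by_cases hj : 0 < w j
    · obtain ⟨k, hk⟩ := hclose j i hj hi
      exact ⟨j - i - 2 * n * k, -k, fun _ => ⟨by ring, hk⟩⟩
    · exact ⟨0, 0, fun h => absurd h hj⟩
  choose c k hck using hc
  set S : Finset ℤ := (Finset.Ico (0 : ℤ) (2 * n)).filter (fun j => 0 < w j) with hS
  -- the representative of `i` in the range of summation
  set i0 : ℤ := i % (2 * n) with hi0
  have hi0w : 0 < w i0 := by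
    have h1 : w i0 = w i := by
      rw [← hper i0 (i / (2 * n)), hi0, Int.emod_add_mul_ediv]
    rwa [h1]
  have hi0S : i0 ∈ S := by
    rw [hS, Finset.mem_filter, Finset.mem_Ico]
    exact ⟨⟨Int.emod_nonneg _ hnZ.ne', Int.emod_lt_of_pos _ hnZ⟩, hi0w⟩
  have hci0 : c i0 = 0 := by
    obtain ⟨h1, h2⟩ := hck i0 hi0w
    have h3 : (2 * (n : ℤ)) ∣ c i0 := by
      rw [h1]
      refine ⟨k i0 - i / (2 * n), ?_⟩
      linear_combination Int.emod_add_mul_ediv i (2 * n)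
    exact Int.eq_zero_of_abs_lt_dvd h3 (by linarith [abs_nonneg (c i0)])
  -- two displacements differ by a representative of the difference of the indices; it is the short
  -- one, because the other representatives are at least `4 * n / 3` in absolute value
  have hdiam : ∀ a ∈ S, ∀ b ∈ S, 3 * (c a - c b) ≤ 2 * n - 1 := by
    intro a ha b hb
    have ha' := (Finset.mem_filter.1 ha).2
    have hb' := (Finset.mem_filter.1 hb).2
    obtain ⟨a1, a2⟩ := hck a ha'
    obtain ⟨b1, b2⟩ := hck b hb'
    obtain ⟨l, hl⟩ := hclose a b ha' hb'
    have h1 : c a - c b = (a - b - 2 * n * l) + 2 * n * (l + k a - k b) := by rw [a1, b1]; ring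
    have a3 := abs_le.1 (le_refl |c a|)
    have b3 := abs_le.1 (le_refl |c b|)
    have l3 := abs_le.1 (le_refl |a - b - 2 * n * l|)
    have h2 : l + k a - k b < 1 := by
      by_contra h
      push Not at h
      have : 2 * (n : ℤ) * 1 ≤ 2 * n * (l + k a - k b) := by gcongr
      linarith
    have : 2 * (n : ℤ) * (l + k a - k b) ≤ 2 * n * 0 :=
      mul_le_mul_of_nonneg_left (by omega) hnZ.le
    omega
  obtain ⟨a, haS, hamax⟩ := S.exists_max_image c ⟨i0, hi0S⟩
  obtain ⟨b, hbS, hbmin⟩ := S.exists_min_image c ⟨i0, hi0S⟩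
  -- the midpoint of the arc that contains all the roots of unity with positive weight
  set μ : ℝ := ((c a : ℝ) + c b) / 2 with hμ
  have hab : 3 * ((c a : ℝ) - c b) ≤ 2 * n - 1 := by exact_mod_cast hdiam a haS b hbS
  have hnear : ∀ j ∈ S, |(c j : ℝ) - μ| ≤ (2 * n - 1) / 6 := by
    intro j hj
    have h1 : (c j : ℝ) ≤ c a := by exact_mod_cast hamax j hj
    have h2 : (c b : ℝ) ≤ c j := by exact_mod_cast hbmin j hj
    rw [abs_le]
    constructor <;> linarith
  have hμ0 : |μ| ≤ (2 * n - 1) / 6 := by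
    have := hnear i0 hi0S
    rwa [hci0, Int.cast_zero, zero_sub, abs_neg] at this
  have hcos : ∀ x : ℝ, |x| < n / 2 → 0 < Real.cos (Real.pi * x / n) := by
    intro x hx
    have hx' := abs_lt.1 hx
    apply Real.cos_pos_of_mem_Ioo
    constructor
    · rw [lt_div_iff₀ (by linarith)]
      nlinarith [Real.pi_pos]
    · rw [div_lt_iff₀ (by linarith)]
      nlinarith [Real.pi_pos]
  have hcos' : ∀ x : ℝ, |x| ≤ n / 2 → 0 ≤ Real.cos (Real.pi * x / n) := by
    intro x hx
    have hx' := abs_le.1 hx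
    apply Real.cos_nonneg_of_mem_Icc
    constructor
    · rw [le_div_iff₀ (by linarith)]
      nlinarith [Real.pi_pos]
    · rw [div_le_iff₀ (by linarith)]
      nlinarith [Real.pi_pos]
  set F : ℂ := ∑ j ∈ Finset.Ico (0 : ℤ) (2 * n), (w j : ℂ) * unitPt n j with hF
  -- after rotating the midpoint of the arc to `1`, all summands have positive real part
  have hpos : 0 < (F * unitPt n (-(i + μ))).re := by
    have hFS : F = ∑ j ∈ S, (w j : ℂ) * unitPt n j := by
      rw [hF, hS, Finset.sum_filter]
      refine Finset.sum_congr rfl fun j _ => ?_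
      split_ifs with h
      · rfl
      · rw [le_antisymm (not_lt.1 h) (hw j)]; simp
    rw [hFS, Finset.sum_mul, Complex.re_sum]
    refine Finset.sum_pos (fun j hj => ?_) ⟨i0, hi0S⟩
    have hwj := (Finset.mem_filter.1 hj).2
    have h1 : unitPt n j * unitPt n (-(i + μ)) = unitPt n (c j - μ) := by
      rw [← unitPt_add, ← unitPt_period hn0 _ (k j), (hck j hwj).1]
      congr 1
      push_cast
      ring
    rw [mul_assoc, h1, Complex.re_ofReal_mul, unitPt_re]
    exact mul_pos hwj (hcos _ ((hnear j hj).trans_lt (by linarith)))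
  -- if `F` were opposite to `unitPt n (i + s)`, which lies within a right angle of the midpoint, the
  -- real part just considered would be nonpositive
  by_contra hz
  rw [Complex.mem_slitPlane_iff, not_or, not_lt, not_not] at hz
  set z : ℂ := F * unitPt n (-(i + s)) with hzdef
  have hzr : z = (z.re : ℂ) := Complex.ext (by simp) (by simpa using hz.2)
  have h1 : F * unitPt n (-(i + μ)) = z.re * unitPt n (s - μ) := by
    rw [← hzr, hzdef, mul_assoc, ← unitPt_add]
    congr 2
    ring
  rw [h1, Complex.re_ofReal_mul, unitPt_re] at hpos
  have h2 : 0 ≤ Real.cos (Real.pi * (s - μ) / n) := by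
    apply hcos'
    calc |s - μ| ≤ |s| + |μ| := abs_sub _ _
      _ ≤ n / 2 := by linarith
  exact absurd hpos (not_lt.2 (mul_nonpos_of_nonpos_of_nonneg hz.1 h2))

/-! ### A winding number argument -/

/-- A connected set of reals that contains no odd multiple of `π` lies between two successive odd
multiples of `π`. -/
lemma exists_int_forall_mem_Ioo {T : Set ℝ} (hT : T.OrdConnected)
    (hodd : ∀ k : ℤ, (2 * k + 1) * Real.pi ∉ T) :
    ∃ m : ℤ, ∀ x ∈ T, x ∈ Ioo ((2 * m - 1) * Real.pi) ((2 * m + 1) * Real.pi) := by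
  rcases T.eq_empty_or_nonempty with rfl | ⟨x₀, hx₀⟩
  · exact ⟨0, by simp⟩
  have hpi := Real.pi_pos
  refine ⟨⌊(x₀ / Real.pi + 1) / 2⌋, fun x hx => ?_⟩
  set m := ⌊(x₀ / Real.pi + 1) / 2⌋ with hm
  have h1 : (2 * m - 1) * Real.pi ≤ x₀ := by
    rw [← le_div_iff₀ hpi]
    linarith [Int.floor_le ((x₀ / Real.pi + 1) / 2)]
  have h2 : x₀ ≤ (2 * m + 1) * Real.pi := by
    rw [← div_le_iff₀ hpi]
    linarith [Int.lt_floor_add_one ((x₀ / Real.pi + 1) / 2)]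
  constructor
  · by_contra h
    refine hodd (m - 1) (hT.out hx hx₀ ⟨?_, ?_⟩) <;> push_cast <;> linarith
  · by_contra h
    exact hodd m (hT.out hx₀ hx ⟨h2, not_lt.1 h⟩)

/-- A continuous `1`-periodic real function cannot follow, up to an error less than `π`, an angle
that grows by `π / n` on each of the `2 * n` pieces of a period. -/
lemma winding_contradiction {n : ℕ} (hn : 0 < n) {t : ℤ → ℝ} (hmono : StrictMono t)
    (hadd : ∀ i, t (i + 2 * n) = t i + 1) {y : ℝ → ℝ} (hy : Continuous y)
    (hper : ∀ s, y (s + 1) = y s)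
    (hodd : ∀ (i : ℤ), ∀ s ∈ Icc (t i) (t (i + 1)), ∀ σ : ℝ, |σ| ≤ 1 / 2 → ∀ k : ℤ,
      y s - Real.pi * (i + σ) / n ≠ (2 * k + 1) * Real.pi) : False := by
  -- on the piece with index `i`, the difference stays in one interval of length `2 * π`
  have hm : ∀ i : ℤ, ∃ m : ℤ, ∀ s ∈ Icc (t i) (t (i + 1)), ∀ σ : ℝ, |σ| ≤ 1 / 2 →
      y s - Real.pi * (i + σ) / n ∈ Ioo ((2 * m - 1) * Real.pi) ((2 * m + 1) * Real.pi) := by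
    intro i
    have hconn : IsPreconnected ((fun p : ℝ × ℝ => y p.1 - Real.pi * (i + p.2) / n) ''
        (Icc (t i) (t (i + 1)) ×ˢ Icc (-(1 / 2)) (1 / 2))) :=
      (isPreconnected_Icc.prod isPreconnected_Icc).image _ (by fun_prop)
    obtain ⟨m, hm⟩ := exists_int_forall_mem_Ioo hconn.ordConnected (by
      rintro k ⟨⟨s, σ⟩, ⟨h1, h2⟩, h3⟩
      exact hodd i s h1 σ (abs_le.2 h2) k h3)
    exact ⟨m, fun s hs σ hσ => hm _ ⟨(s, σ), ⟨hs, abs_le.1 hσ⟩, rfl⟩⟩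
  choose m hm using hm
  have hpi := Real.pi_pos
  have huniq : ∀ (x : ℝ) (a b : ℤ), x ∈ Ioo ((2 * a - 1) * Real.pi) ((2 * a + 1) * Real.pi) →
      x ∈ Ioo ((2 * b - 1) * Real.pi) ((2 * b + 1) * Real.pi) → a = b := by
    intro x a b ha hb
    have h1 : (2 * (a : ℝ) - 1) < 2 * b + 1 :=
      lt_of_mul_lt_mul_right (ha.1.trans hb.2) hpi.le
    have h2 : (2 * (b : ℝ) - 1) < 2 * a + 1 :=
      lt_of_mul_lt_mul_right (hb.1.trans ha.2) hpi.le
    norm_cast at h1 h2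
    omega
  have hstep : ∀ i, m i = m (i + 1) := by
    intro i
    -- the point `t (i + 1)` and the angle half way between steps `i` and `i + 1` serve both
    have h1 := hm i (t (i + 1)) ⟨(hmono (by omega)).le, le_rfl⟩ (1 / 2) (by norm_num)
    have h2 := hm (i + 1) (t (i + 1)) ⟨le_rfl, (hmono (by omega)).le⟩ (-(1 / 2)) (by norm_num)
    refine huniq _ _ _ h1 ?_
    convert h2 using 3
    push_cast
    ring
  have hconst : ∀ k : ℕ, m k = m 0 := by
    intro k
    induction k with
    | zero => rfl
    | succ k ih => rw [← ih]; push_cast; exact (hstep _).symm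
  have h0 := hm 0 (t 0) ⟨le_rfl, (hmono (by omega)).le⟩ 0 (by norm_num)
  have h1 := hm (2 * n) (t (2 * n)) ⟨le_rfl, (hmono (by omega)).le⟩ 0 (by norm_num)
  have h2 : t (2 * n) = t 0 + 1 := by rw [← hadd 0, zero_add]
  have h3 : m (2 * n) = m 0 := by exact_mod_cast hconst (2 * n)
  have hn' : (n : ℝ) ≠ 0 := by exact_mod_cast hn.ne'
  have h4 : Real.pi * (((2 * n : ℤ) : ℝ) + 0) / n = 2 * Real.pi := by
    push_cast
    field_simp
    ring
  rw [h2, hper, h3, h4] at h1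
  have h5 : Real.pi * (((0 : ℤ) : ℝ) + 0) / n = 0 := by simp
  rw [h5] at h0
  linarith [h0.1, h0.2, h1.1, h1.2]

end KnotProj

namespace KnotProj

open Set Topology

/-! ### Closed curves with labelled transversal double points -/

/-- A local model of a curve near a parameter `s` where it is embedded: `Ψ` maps a closed square
onto a neighbourhood of `c s`, the horizontal axis parametrizes the curve, and nothing off this
axis lies on the curve. -/
structure IsArcChart {X : Type*} [TopologicalSpace X] (c : ℝ → X) (s ε : ℝ) (Ψ : ℝ × ℝ → X) :
    Prop where
  pos : 0 < ε
  continuousOn : ContinuousOn Ψ (Icc (-ε) ε ×ˢ Icc (-ε) ε)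
  image_mem_nhds : Ψ '' (Icc (-ε) ε ×ˢ Icc (-ε) ε) ∈ 𝓝 (c s)
  axis : ∀ x ∈ Icc (-ε) ε, Ψ (x, 0) = c (s + x)
  off_axis : ∀ z ∈ Icc (-ε) ε ×ˢ Icc (-ε) ε, Ψ z ∈ range c → z.2 = 0

/-- A local model of a curve near a double point `c s = c s'`: `Ψ` maps a closed square onto a
neighbourhood of the double point, the two axes parametrize the two branches of the curve, and
nothing off the axes lies on the curve. -/
structure IsCrossChart {X : Type*} [TopologicalSpace X] (c : ℝ → X) (s s' ε : ℝ) (Ψ : ℝ × ℝ → X) :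
    Prop where
  pos : 0 < ε
  continuousOn : ContinuousOn Ψ (Icc (-ε) ε ×ˢ Icc (-ε) ε)
  image_mem_nhds : Ψ '' (Icc (-ε) ε ×ˢ Icc (-ε) ε) ∈ 𝓝 (c s)
  axis_fst : ∀ x ∈ Icc (-ε) ε, Ψ (x, 0) = c (s + x)
  axis_snd : ∀ y ∈ Icc (-ε) ε, Ψ (0, y) = c (s' + y)
  off_axes : ∀ z ∈ Icc (-ε) ε ×ˢ Icc (-ε) ε, Ψ z ∈ range c → z.1 = 0 ∨ z.2 = 0

/-- A closed curve, given as a `1`-periodic map `c`, whose only singularities are `n` transversal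
double points; `t` enumerates the parameters of the double points in increasing order, so that
`t (i + 2 * n) = t i + 1`. Transversality is expressed by the existence of arbitrarily small
local models. -/
structure CrossingCurve (X : Type*) [TopologicalSpace X] (n : ℕ) where
  c : ℝ → X
  t : ℤ → ℝ
  continuous : Continuous c
  periodic : ∀ s, c (s + 1) = c s
  mono : StrictMono t
  add_period : ∀ i, t (i + 2 * n) = t i + 1
  simple : ∀ s s', c s = c s' → (∃ k : ℤ, s' = s + k) ∨ (s ∈ range t ∧ s' ∈ range t)
  crossing : ∀ k, ∃ l, c (t k) = c (t l) ∧ ∀ j : ℤ, t k ≠ t l + j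
  arcChart : ∀ s ∉ range t, ∀ O ∈ 𝓝 (c s), ∃ ε Ψ, IsArcChart c s ε Ψ ∧
    Ψ '' (Icc (-ε) ε ×ˢ Icc (-ε) ε) ⊆ O
  crossChart : ∀ k l, c (t k) = c (t l) → (∀ j : ℤ, t k ≠ t l + j) → ∀ O ∈ 𝓝 (c (t k)),
    ∃ ε Ψ, IsCrossChart c (t k) (t l) ε Ψ ∧ Ψ '' (Icc (-ε) ε ×ˢ Icc (-ε) ε) ⊆ O

namespace CrossingCurve

variable {X : Type*} [TopologicalSpace X] {n : ℕ} (C : CrossingCurve X n)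

lemma c_add_int (s : ℝ) (k : ℤ) : C.c (s + k) = C.c s := by
  have h : Function.Periodic C.c 1 := C.periodic
  simpa using h.int_mul k s

lemma t_add_mul (i k : ℤ) : C.t (i + 2 * n * k) = C.t i + k := by
  induction k using Int.induction_on with
  | zero => simp
  | succ k ih =>
    rw [show i + 2 * (n : ℤ) * (k + 1) = (i + 2 * n * k) + 2 * n by ring, C.add_period, ih]
    push_cast; ring
  | pred k ih =>
    have := C.add_period (i + 2 * n * (-k - 1))
    rw [show i + 2 * (n : ℤ) * (-k - 1) + 2 * n = i + 2 * n * (-k) by ring, ih] at this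
    push_cast at this ⊢; linarith

/-- The open arc of the curve between two successive parameters of double points. -/
def arc (i : ℤ) : Set X := C.c '' Ioo (C.t i) (C.t (i + 1))

/-- The closed arc of the curve between two successive parameters of double points. -/
def edge (i : ℤ) : Set X := C.c '' Icc (C.t i) (C.t (i + 1))

/-- The closed arc of the curve complementary to the arc with index `i`. -/
def rest (i : ℤ) : Set X := C.c '' Icc (C.t (i + 1)) (C.t i + 1)

/-- The set of double points. -/
def V : Set X := C.c '' range C.t

/-- The component of the complement of the curve that contains `x`. -/
def face (x : X) : Set X := connectedComponentIn (range C.c)ᶜ x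

/-- The edge with index `i` lies in the boundary of the face of `x`. -/
def Bd (x : X) (i : ℤ) : Prop := C.edge i ⊆ frontier (C.face x)

lemma t_lt (i : ℤ) : C.t i < C.t (i + 1) := C.mono (by omega)

lemma t_mem_V (i : ℤ) : C.c (C.t i) ∈ C.V := mem_image_of_mem _ ⟨i, rfl⟩

lemma arc_subset_edge (i : ℤ) : C.arc i ⊆ C.edge i := image_mono Ioo_subset_Icc_self

lemma t_left_mem_edge (i : ℤ) : C.c (C.t i) ∈ C.edge i :=
  mem_image_of_mem _ ⟨le_rfl, (C.t_lt i).le⟩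

lemma t_right_mem_edge (i : ℤ) : C.c (C.t (i + 1)) ∈ C.edge i :=
  mem_image_of_mem _ ⟨(C.t_lt i).le, le_rfl⟩

lemma edge_add_mul (i k : ℤ) : C.edge (i + 2 * n * k) = C.edge i := by
  rw [edge, edge, show i + 2 * (n : ℤ) * k + 1 = i + 1 + 2 * n * k by ring, C.t_add_mul,
    C.t_add_mul, ← image_add_const_Icc, image_image]
  simp only [C.c_add_int]

lemma arc_add_mul (i k : ℤ) : C.arc (i + 2 * n * k) = C.arc i := by
  rw [arc, arc, show i + 2 * (n : ℤ) * k + 1 = i + 1 + 2 * n * k by ring, C.t_add_mul,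
    C.t_add_mul, ← image_add_const_Ioo, image_image]
  simp only [C.c_add_int]

lemma notMem_range_t {i : ℤ} {s : ℝ} (hs : s ∈ Ioo (C.t i) (C.t (i + 1))) : s ∉ range C.t := by
  rintro ⟨j, rfl⟩
  have h1 := C.mono.lt_iff_lt.1 hs.1
  have h2 := C.mono.lt_iff_lt.1 hs.2
  omega

lemma exists_mem_Ico (s : ℝ) : ∃ i, s ∈ Ico (C.t i) (C.t (i + 1)) := by
  obtain ⟨m, hm⟩ := exists_int_gt (s - C.t 0)
  obtain ⟨m', hm'⟩ := exists_int_lt (s - C.t 0)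
  have h1 : s < C.t (2 * n * m) := by
    have := C.t_add_mul 0 m
    rw [zero_add] at this
    linarith
  have h2 : C.t (2 * n * m') < s := by
    have := C.t_add_mul 0 m'
    rw [zero_add] at this
    linarith
  obtain ⟨i, hi, hmax⟩ := Int.exists_greatest_of_bdd (P := fun i => C.t i ≤ s)
    ⟨2 * n * m, fun z hz => (C.mono.lt_iff_lt.1 (lt_of_le_of_lt hz h1)).le⟩ ⟨_, h2.le⟩
  refine ⟨i, hi, ?_⟩
  by_contra h
  have := hmax (i + 1) (not_lt.1 h)
  omega

lemma exists_mem_Ico_zero_add (i j : ℤ) (hn : 0 < n) : ∃ k : ℤ, j + 2 * n * k ∈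
    Ico i (i + 2 * n) := by
  have hnZ : (0 : ℤ) < 2 * n := by exact_mod_cast (by omega : 0 < 2 * n)
  refine ⟨-((j - i) / (2 * n)), ?_, ?_⟩ <;>
  nlinarith [Int.emod_add_mul_ediv (j - i) (2 * n), Int.emod_nonneg (j - i) hnZ.ne',
    Int.emod_lt_of_pos (j - i) hnZ]

/-- The parameters `s`, `s'` of one point of an open arc agree up to an integer. -/
lemma eq_add_int_of_mem_Ioo {i : ℤ} {s s' : ℝ} (hs : s ∈ Ioo (C.t i) (C.t (i + 1)))
    (h : C.c s = C.c s') : ∃ k : ℤ, s' = s + k :=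
  (C.simple s s' h).resolve_right fun h' => C.notMem_range_t hs h'.1

lemma disjoint_arc_rest (i : ℤ) : Disjoint (C.arc i) (C.rest i) := by
  rw [Set.disjoint_left]
  rintro _ ⟨s, hs, rfl⟩ ⟨s', hs', h⟩
  obtain ⟨k, rfl⟩ := C.eq_add_int_of_mem_Ioo hs h.symm
  have h1 : (0 : ℝ) < k := by linarith [hs.2, hs'.1]
  have h2 : (k : ℝ) < 1 := by linarith [hs.1, hs'.2]
  norm_cast at h1 h2
  omega

lemma exists_mem_Ico_one (i : ℤ) {x : X} (hx : x ∈ range C.c) :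
    ∃ s ∈ Ico (C.t i) (C.t i + 1), C.c s = x := by
  obtain ⟨s, rfl⟩ := hx
  refine ⟨s + (-⌊s - C.t i⌋ : ℤ), ⟨?_, ?_⟩, C.c_add_int _ _⟩
  · push_cast; linarith [Int.floor_le (s - C.t i)]
  · push_cast; linarith [Int.lt_floor_add_one (s - C.t i)]

lemma mem_arc_of_notMem_rest {i : ℤ} {x : X} (hx : x ∈ range C.c) (h : x ∉ C.rest i) :
    x ∈ C.arc i := by
  obtain ⟨s, hs, rfl⟩ := C.exists_mem_Ico_one i hx
  have h1 : s < C.t (i + 1) := by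
    by_contra h'
    exact h ⟨s, ⟨not_lt.1 h', hs.2.le⟩, rfl⟩
  rcases hs.1.eq_or_lt with h2 | h2
  · refine absurd ⟨C.t i + 1, ⟨?_, le_rfl⟩, ?_⟩ h
    · rw [← C.add_period]
      apply C.mono.monotone
      by_contra h3
      have h4 : n = 0 := by omega
      have h5 := C.add_period i
      subst h4
      simp at h5
    · rw [C.periodic, h2]
  · exact ⟨s, ⟨h2, h1⟩, rfl⟩

lemma range_eq_image : range C.c = C.c '' Icc (C.t 0) (C.t 0 + 1) := by
  refine Subset.antisymm (fun x hx => ?_) (image_subset_range _ _)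
  obtain ⟨s, hs, rfl⟩ := C.exists_mem_Ico_one 0 hx
  exact ⟨s, Ico_subset_Icc_self hs, rfl⟩

lemma V_eq (hn : 0 < n) : C.V = (fun i => C.c (C.t i)) '' Ico (0 : ℤ) (0 + 2 * n) := by
  refine Subset.antisymm ?_ ?_
  · rintro _ ⟨_, ⟨i, rfl⟩, rfl⟩
    obtain ⟨k, hk⟩ := exists_mem_Ico_zero_add 0 i hn
    refine ⟨_, hk, ?_⟩
    simp only
    rw [C.t_add_mul, C.c_add_int]
  · rintro _ ⟨i, -, rfl⟩
    exact C.t_mem_V i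

lemma V_finite (hn : 0 < n) : C.V.Finite := by
  rw [C.V_eq hn]
  exact (finite_Ico _ _).image _

/-- A double point on the edge with index `i` is one of its end points. -/
lemma exists_of_mem_V_of_mem_edge {v : X} (hv : v ∈ C.V) {i : ℤ} (hi : v ∈ C.edge i) :
    ∃ k, C.c (C.t k) = v ∧ (i = k ∨ i = k - 1) := by
  obtain ⟨s, hs, rfl⟩ := hi
  rcases hs.1.eq_or_lt with h1 | h1
  · exact ⟨i, by rw [h1], Or.inl rfl⟩
  rcases hs.2.eq_or_lt with h2 | h2
  · exact ⟨i + 1, by rw [h2], Or.inr (by omega)⟩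
  exfalso
  obtain ⟨_, ⟨j, rfl⟩, hj⟩ := hv
  obtain ⟨k, hk⟩ := C.eq_add_int_of_mem_Ioo ⟨h1, h2⟩ hj.symm
  refine C.notMem_range_t ⟨h1, h2⟩ ⟨j + 2 * n * (-k), ?_⟩
  rw [C.t_add_mul, hk]
  push_cast
  ring

section Hausdorff

variable [T2Space X]

lemma isClosed_range : IsClosed (range C.c) := by
  rw [C.range_eq_image]
  exact (isCompact_Icc.image C.continuous).isClosed

lemma isClosed_edge (i : ℤ) : IsClosed (C.edge i) :=
  (isCompact_Icc.image C.continuous).isClosed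

lemma isClosed_rest (i : ℤ) : IsClosed (C.rest i) :=
  (isCompact_Icc.image C.continuous).isClosed

end Hausdorff

/-! ### Faces and their boundary edges -/

lemma mem_face {x : X} (hx : x ∉ range C.c) : x ∈ C.face x := mem_connectedComponentIn hx

lemma face_subset (x : X) : C.face x ⊆ (range C.c)ᶜ := connectedComponentIn_subset _ _

lemma face_eq {x y : X} (h : y ∈ C.face x) : C.face y = C.face x :=
  (connectedComponentIn_eq h).symm

/-- A connected piece of a chart that avoids the curve lies in one face, so the images of its limit
points lie in the closure of this face. -/
lemma mem_closure_face {Ψ : ℝ × ℝ → X} {S R : Set (ℝ × ℝ)} (hΨ : ContinuousOn Ψ S)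
    (hRS : R ⊆ S) (hR : IsPreconnected R) (hav : ∀ z ∈ R, Ψ z ∉ range C.c) {z w : ℝ × ℝ}
    (hz : z ∈ R) (hw : w ∈ closure R) (hwS : w ∈ S) : Ψ w ∈ closure (C.face (Ψ z)) := by
  have h1 : Ψ '' R ⊆ C.face (Ψ z) :=
    (hR.image _ (hΨ.mono hRS)).subset_connectedComponentIn (mem_image_of_mem _ hz)
      (by rintro _ ⟨z, hz, rfl⟩; exact hav z hz)
  refine closure_mono h1 ?_
  exact ((hΨ w hwS).mono hRS).mem_closure_image hw

lemma _root_.Real.exists_half_interval {ε a : ℝ} (ha : a ∈ Icc (-ε) ε) (h0 : a ≠ 0) :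
    ∃ R : Set ℝ, R ⊆ Icc (-ε) ε ∧ IsPreconnected R ∧ a ∈ R ∧ (∀ b ∈ R, b ≠ 0) ∧
      ((0 < a ∧ closure R = Icc 0 ε) ∨ (a < 0 ∧ closure R = Icc (-ε) 0)) := by
  rcases h0.lt_or_gt with h | h
  · refine ⟨Ico (-ε) 0, fun b hb => ⟨hb.1, by linarith [hb.2, ha.1]⟩, isPreconnected_Ico,
      ⟨ha.1, h⟩, fun b hb => hb.2.ne, Or.inr ⟨h, closure_Ico (by linarith [ha.1])⟩⟩
  · refine ⟨Ioc 0 ε, fun b hb => ⟨by linarith [hb.1, ha.2], hb.2⟩, isPreconnected_Ioc,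
      ⟨h, ha.2⟩, fun b hb => hb.1.ne', Or.inl ⟨h, closure_Ioc (by linarith [ha.2])⟩⟩

lemma _root_.KnotProj.IsArcChart.mem_closure_face {s ε : ℝ} {Ψ : ℝ × ℝ → X}
    (h : IsArcChart C.c s ε Ψ) {z : ℝ × ℝ} (hz : z ∈ Icc (-ε) ε ×ˢ Icc (-ε) ε)
    (hzD : Ψ z ∉ range C.c) {x : ℝ} (hx : x ∈ Icc (-ε) ε) :
    C.c (s + x) ∈ closure (C.face (Ψ z)) := by
  have hε := h.pos
  have hz2 : z.2 ≠ 0 := by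
    intro h0
    refine hzD ⟨s + z.1, ?_⟩
    rw [← h.axis _ hz.1, ← h0]
  obtain ⟨R, hRs, hRc, hzR, hR0, hcl⟩ := Real.exists_half_interval hz.2 hz2
  have h0 : (0 : ℝ) ∈ closure R := by
    rcases hcl with hcl | hcl <;> rw [hcl.2] <;> constructor <;> linarith
  rw [← h.axis x hx]
  refine C.mem_closure_face h.continuousOn (R := Icc (-ε) ε ×ˢ R) (prod_mono le_rfl hRs)
    (isPreconnected_Icc.prod hRc) ?_ ⟨hz.1, hzR⟩ ?_ ⟨hx, by constructor <;> linarith⟩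
  · rintro w ⟨hw1, hw2⟩ hw
    exact hR0 _ hw2 (h.off_axis w ⟨hw1, hRs hw2⟩ hw)
  · rw [closure_prod_eq]
    exact ⟨subset_closure hx, h0⟩

lemma exists_mem_Ioo_right {k : ℤ} {ε : ℝ} (hε : 0 < ε) :
    ∃ x ∈ Icc 0 ε, C.t k + x ∈ Ioo (C.t k) (C.t (k + 1)) := by
  have h := C.t_lt k
  refine ⟨min ε ((C.t (k + 1) - C.t k) / 2), ⟨le_min hε.le (by linarith), min_le_left _ _⟩, ?_, ?_⟩
  · linarith [lt_min hε (show 0 < (C.t (k + 1) - C.t k) / 2 by linarith)]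
  · linarith [min_le_right ε ((C.t (k + 1) - C.t k) / 2)]

lemma exists_mem_Ioo_left {k : ℤ} {ε : ℝ} (hε : 0 < ε) :
    ∃ x ∈ Icc (-ε) 0, C.t k + x ∈ Ioo (C.t (k - 1)) (C.t (k - 1 + 1)) := by
  have h := C.t_lt (k - 1)
  rw [sub_add_cancel] at h ⊢
  have h1 := lt_min hε (show 0 < (C.t k - C.t (k - 1)) / 2 by linarith)
  have h2 := min_le_left ε ((C.t k - C.t (k - 1)) / 2)
  have h3 := min_le_right ε ((C.t k - C.t (k - 1)) / 2)
  refine ⟨-min ε ((C.t k - C.t (k - 1)) / 2), ⟨by linarith, by linarith⟩, ?_, ?_⟩ <;> linarith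

variable [LocallyConnectedSpace X] [T2Space X]

lemma isOpen_face (x : X) : IsOpen (C.face x) := C.isClosed_range.isOpen_compl.connectedComponentIn

lemma frontier_face_subset (x : X) : frontier (C.face x) ⊆ range C.c := by
  intro y hy
  by_contra hyD
  have h1 : y ∈ closure (C.face x) := hy.1
  obtain ⟨z, hz1, hz2⟩ := mem_closure_iff.1 h1 _ (C.isOpen_face y) (C.mem_face hyD)
  have h2 : y ∈ C.face x := by
    rw [← C.face_eq hz2, C.face_eq hz1]
    exact C.mem_face hyD
  rw [(C.isOpen_face x).frontier_eq] at hy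
  exact hy.2 h2

/-- If one point of an open arc lies in the closure of a face, then the whole arc does: near each
point of the arc the face contains one of the two sides of the arc. -/
lemma bd_of_mem_closure {x : X} {i : ℤ} {s : ℝ} (hs : s ∈ Ioo (C.t i) (C.t (i + 1)))
    (h : C.c s ∈ closure (C.face x)) : C.Bd x i := by
  set T : Set ℝ := C.c ⁻¹' closure (C.face x) with hT
  have hTc : IsClosed T := isClosed_closure.preimage C.continuous
  -- `T` is relatively open in the open interval of the arc, by means of the local models
  have hint : ∀ r ∈ Ioo (C.t i) (C.t (i + 1)), r ∈ T → r ∈ interior T := by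
    intro r hr hrT
    obtain ⟨ε, Ψ, hΨ, -⟩ := C.arcChart r (C.notMem_range_t hr) univ Filter.univ_mem
    have hε := hΨ.pos
    obtain ⟨_, ⟨z, hz, rfl⟩, hz2⟩ := mem_closure_iff_nhds.1 hrT _ hΨ.image_mem_nhds
    rw [mem_interior_iff_mem_nhds]
    refine Filter.mem_of_superset (Icc_mem_nhds (a := r - ε) (b := r + ε) (by linarith)
      (by linarith)) fun r' hr' => ?_
    have := hΨ.mem_closure_face C hz (C.face_subset _ hz2) (x := r' - r)
      ⟨by linarith [hr'.1], by linarith [hr'.2]⟩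
    rwa [C.face_eq hz2, add_sub_cancel] at this
  have hsub : Ioo (C.t i) (C.t (i + 1)) ⊆ interior T := by
    refine isPreconnected_Ioo.subset_left_of_subset_union isOpen_interior hTc.isOpen_compl
      (disjoint_compl_right.mono_left interior_subset) (fun r hr => ?_) ⟨s, hs, hint s hs h⟩
    by_cases hr' : r ∈ T
    · exact Or.inl (hint r hr hr')
    · exact Or.inr hr'
  have hsub' : Icc (C.t i) (C.t (i + 1)) ⊆ T := by
    rw [← closure_Ioo (C.t_lt i).ne]
    exact closure_minimal (hsub.trans interior_subset) hTc
  rintro _ ⟨r, hr, rfl⟩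
  rw [(C.isOpen_face x).frontier_eq]
  exact ⟨hsub' hr, fun h' => C.face_subset _ h' ⟨r, rfl⟩⟩

/-- Each quadrant of a chart at a double point lies in a face whose boundary contains the two edges
that bound the quadrant. -/
lemma bd_of_isCrossChart {k l : ℤ} {ε : ℝ} {Ψ : ℝ × ℝ → X}
    (h : IsCrossChart C.c (C.t k) (C.t l) ε Ψ) {z : ℝ × ℝ}
    (hz : z ∈ Icc (-ε) ε ×ˢ Icc (-ε) ε) (hzD : Ψ z ∉ range C.c) :
    C.Bd (Ψ z) (if 0 < z.1 then k else k - 1) ∧ C.Bd (Ψ z) (if 0 < z.2 then l else l - 1) := by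
  have hε := h.pos
  have hz1 : z.1 ≠ 0 := by
    intro h0
    refine hzD ⟨C.t l + z.2, ?_⟩
    rw [← h.axis_snd _ hz.2, ← h0]
  have hz2 : z.2 ≠ 0 := by
    intro h0
    refine hzD ⟨C.t k + z.1, ?_⟩
    rw [← h.axis_fst _ hz.1, ← h0]
  obtain ⟨R₁, hs₁, hc₁, hm₁, hn₁, hcl₁⟩ := Real.exists_half_interval hz.1 hz1
  obtain ⟨R₂, hs₂, hc₂, hm₂, hn₂, hcl₂⟩ := Real.exists_half_interval hz.2 hz2
  have h01 : (0 : ℝ) ∈ closure R₁ := by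
    rcases hcl₁ with hcl | hcl <;> rw [hcl.2] <;> constructor <;> linarith
  have h02 : (0 : ℝ) ∈ closure R₂ := by
    rcases hcl₂ with hcl | hcl <;> rw [hcl.2] <;> constructor <;> linarith
  have hcl : ∀ w ∈ closure R₁ ×ˢ closure R₂, Ψ w ∈ closure (C.face (Ψ z)) := by
    intro w hw
    refine C.mem_closure_face h.continuousOn (prod_mono hs₁ hs₂) (hc₁.prod hc₂) ?_
      (z := z) ⟨hm₁, hm₂⟩ (by rwa [closure_prod_eq]) ?_
    · rintro w ⟨hw1, hw2⟩ hw
      rcases h.off_axes w ⟨hs₁ hw1, hs₂ hw2⟩ hw with h0 | h0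
      · exact hn₁ _ hw1 h0
      · exact hn₂ _ hw2 h0
    · exact prod_mono (closure_minimal hs₁ isClosed_Icc) (closure_minimal hs₂ isClosed_Icc) hw
  constructor
  · rcases hcl₁ with hcl' | hcl'
    · rw [if_pos hcl'.1]
      obtain ⟨x, hx, hx'⟩ := C.exists_mem_Ioo_right (k := k) hε
      refine C.bd_of_mem_closure hx' ?_
      rw [← h.axis_fst x ⟨by linarith [hx.1], hx.2⟩]
      exact hcl _ ⟨by rw [hcl'.2]; exact hx, h02⟩
    · rw [if_neg hcl'.1.not_gt]
      obtain ⟨x, hx, hx'⟩ := C.exists_mem_Ioo_left (k := k) hε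
      refine C.bd_of_mem_closure hx' ?_
      rw [← h.axis_fst x ⟨hx.1, by linarith [hx.2]⟩]
      exact hcl _ ⟨by rw [hcl'.2]; exact hx, h02⟩
  · rcases hcl₂ with hcl' | hcl'
    · rw [if_pos hcl'.1]
      obtain ⟨x, hx, hx'⟩ := C.exists_mem_Ioo_right (k := l) hε
      refine C.bd_of_mem_closure hx' ?_
      rw [← h.axis_snd x ⟨by linarith [hx.1], hx.2⟩]
      exact hcl _ ⟨h01, by rw [hcl'.2]; exact hx⟩
    · rw [if_neg hcl'.1.not_gt]
      obtain ⟨x, hx, hx'⟩ := C.exists_mem_Ioo_left (k := l) hε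
      refine C.bd_of_mem_closure hx' ?_
      rw [← h.axis_snd x ⟨hx.1, by linarith [hx.2]⟩]
      exact hcl _ ⟨h01, by rw [hcl'.2]; exact hx⟩

/-- At a double point, each of the two edges ending there on one branch has a common face with each
of the two edges on the other branch. -/
lemma exists_corner {k l : ℤ} (hkl : C.c (C.t k) = C.c (C.t l)) (hne : ∀ j : ℤ, C.t k ≠ C.t l + j)
    {i j : ℤ} (hi : i = k ∨ i = k - 1) (hj : j = l ∨ j = l - 1) :
    ∃ x ∉ range C.c, C.Bd x i ∧ C.Bd x j := by
  obtain ⟨ε, Ψ, hΨ, -⟩ := C.crossChart k l hkl hne univ Filter.univ_mem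
  have hε := hΨ.pos
  have key : ∀ a b : ℝ, (a = ε ∨ a = -ε) → (b = ε ∨ b = -ε) →
      (a, b) ∈ Icc (-ε) ε ×ˢ Icc (-ε) ε ∧ Ψ (a, b) ∉ range C.c := by
    intro a b ha hb
    have hmem : (a, b) ∈ Icc (-ε) ε ×ˢ Icc (-ε) ε := by
      rcases ha with rfl | rfl <;> rcases hb with rfl | rfl <;>
      exact ⟨⟨by simp; try linarith, by simp; try linarith⟩,
        ⟨by simp; try linarith, by simp; try linarith⟩⟩
    refine ⟨hmem, fun h => ?_⟩
    rcases hΨ.off_axes _ hmem h with h0 | h0 <;> simp only at h0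
    · rcases ha with rfl | rfl <;> linarith
    · rcases hb with rfl | rfl <;> linarith
  have hex : ∀ m p : ℤ, (m = p ∨ m = p - 1) →
      ∃ a : ℝ, (a = ε ∨ a = -ε) ∧ (if 0 < a then p else p - 1) = m := by
    rintro m p (rfl | rfl)
    · exact ⟨ε, Or.inl rfl, if_pos hε⟩
    · exact ⟨-ε, Or.inr rfl, if_neg (by linarith)⟩
  obtain ⟨a, ha, hai⟩ := hex i k hi
  obtain ⟨b, hb, hbj⟩ := hex j l hj
  obtain ⟨h1, h2⟩ := key a b ha hb
  have h3 := C.bd_of_isCrossChart hΨ h1 h2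
  simp only [hai, hbj] at h3
  exact ⟨_, h2, h3⟩

end CrossingCurve

end KnotProj

namespace KnotProj

open Set Topology

namespace CrossingCurve

/-! ### An open cover indexed by the edges -/

variable {X : Type*} [TopologicalSpace X] {n : ℕ} (C : CrossingCurve X n)
  [LocallyConnectedSpace X] [T2Space X]

/-- The double points have pairwise disjoint closed neighbourhoods that meet no edge not ending
there, and such that every face meeting the neighbourhood is bounded by an edge ending there. -/
lemma exists_crossing_nhds (hn : 0 < n) : ∃ N : X → Set X, (∀ v ∈ C.V, IsClosed (N v) ∧ N v ∈ 𝓝 v ∧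
    (∀ i, v ∉ C.edge i → Disjoint (N v) (C.edge i)) ∧
    ∀ x ∈ N v, x ∉ range C.c → ∃ i, v ∈ C.edge i ∧ C.Bd x i) ∧ C.V.PairwiseDisjoint N := by
  obtain ⟨O, hO, hdisj⟩ := (C.V_finite hn).t2_separation
  have key : ∀ v : X, ∃ N : Set X, v ∈ C.V → N ⊆ O v ∧ IsClosed N ∧ N ∈ 𝓝 v ∧
      (∀ i, v ∉ C.edge i → Disjoint N (C.edge i)) ∧
      ∀ x ∈ N, x ∉ range C.c → ∃ i, v ∈ C.edge i ∧ C.Bd x i := by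
    intro v
    by_cases hv : v ∈ C.V
    swap
    · exact ⟨∅, fun h => absurd h hv⟩
    obtain ⟨_, ⟨k, rfl⟩, rfl⟩ := hv
    obtain ⟨l, hl, hne⟩ := C.crossing k
    have hE : (⋂ i ∈ {i ∈ Ico (0 : ℤ) (0 + 2 * n) | C.c (C.t k) ∉ C.edge i}, (C.edge i)ᶜ) ∈
        𝓝 (C.c (C.t k)) := by
      rw [Filter.biInter_mem ((finite_Ico _ _).subset (sep_subset _ _))]
      exact fun i hi => (C.isClosed_edge i).isOpen_compl.mem_nhds hi.2
    obtain ⟨ε, Ψ, hΨ, hsub⟩ := C.crossChart k l hl hne _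
      (Filter.inter_mem ((hO (C.c (C.t k))).2.mem_nhds (hO _).1) hE)
    refine ⟨_, fun _ => ⟨hsub.trans inter_subset_left, ?_, hΨ.image_mem_nhds, ?_, ?_⟩⟩
    · exact ((isCompact_Icc.prod isCompact_Icc).image_of_continuousOn hΨ.continuousOn).isClosed
    · intro i hi
      obtain ⟨m, hm⟩ := exists_mem_Ico_zero_add 0 i hn
      rw [Set.disjoint_left]
      intro x hx hxi
      have h1 := (hsub hx).2
      simp only [mem_iInter] at h1
      refine h1 (i + 2 * n * m) ⟨hm, ?_⟩ ?_
      · rwa [C.edge_add_mul]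
      · rwa [C.edge_add_mul]
    · rintro _ ⟨z, hz, rfl⟩ hzD
      refine ⟨_, ?_, (C.bd_of_isCrossChart hΨ hz hzD).1⟩
      split_ifs
      · exact C.t_left_mem_edge k
      · have := C.t_right_mem_edge (k - 1)
        rwa [sub_add_cancel] at this
  choose N hN using key
  exact ⟨N, fun v hv => (hN v hv).2, fun v hv w hw hvw =>
    (hdisj hv hw hvw).mono (hN v hv).1 (hN w hw).1⟩

/-- The open set attached to the edge with index `i`, for a given choice `N` of neighbourhoods of
the double points: the open arc, the faces bounded by the edge except for their parts near double
points not on the edge, and the neighbourhoods of the end points of the edge. -/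
def U (N : X → Set X) (i : ℤ) : Set X :=
  {x | (x ∉ range C.c ∧ C.Bd x i ∧ ∀ v ∈ C.V, v ∉ C.edge i → x ∉ N v) ∨ x ∈ C.arc i ∨
    ∃ v ∈ C.V, v ∈ C.edge i ∧ x ∈ interior (N v)}

omit [LocallyConnectedSpace X] [T2Space X] in
lemma U_add_mul (N : X → Set X) (i k : ℤ) : C.U N (i + 2 * n * k) = C.U N i := by
  simp only [U, Bd, C.edge_add_mul, C.arc_add_mul]

omit [LocallyConnectedSpace X] [T2Space X] in
lemma mem_U_of_mem_Icc {N : X → Set X} (hN : ∀ v ∈ C.V, N v ∈ 𝓝 v) {i : ℤ} {s : ℝ}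
    (hs : s ∈ Icc (C.t i) (C.t (i + 1))) : C.c s ∈ C.U N i := by
  rcases hs.1.eq_or_lt with h1 | h1
  · rw [← h1]
    exact Or.inr (Or.inr ⟨_, C.t_mem_V i, C.t_left_mem_edge i,
      mem_interior_iff_mem_nhds.2 (hN _ (C.t_mem_V i))⟩)
  rcases hs.2.eq_or_lt with h2 | h2
  · rw [h2]
    exact Or.inr (Or.inr ⟨_, C.t_mem_V (i + 1), C.t_right_mem_edge i,
      mem_interior_iff_mem_nhds.2 (hN _ (C.t_mem_V (i + 1)))⟩)
  · exact Or.inr (Or.inl ⟨s, ⟨h1, h2⟩, rfl⟩)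

/-- Openness at a point of the open arc holds because all faces nearby are bounded by the arc. -/
lemma isOpen_U (hn : 0 < n) {N : X → Set X} (hN : ∀ v ∈ C.V, IsClosed (N v) ∧
    ∀ i, v ∉ C.edge i → Disjoint (N v) (C.edge i)) (i : ℤ) : IsOpen (C.U N i) := by
  rw [isOpen_iff_mem_nhds]
  have havoid : ∀ x, (∀ v ∈ C.V, v ∉ C.edge i → x ∉ N v) →
      (⋂ v ∈ {v ∈ C.V | v ∉ C.edge i}, (N v)ᶜ) ∈ 𝓝 x := by
    intro x hx
    rw [Filter.biInter_mem ((C.V_finite hn).subset (sep_subset _ _))]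
    exact fun v hv => (hN v hv.1).1.isOpen_compl.mem_nhds (hx v hv.1 hv.2)
  have hmem : ∀ y ∈ ⋂ v ∈ {v ∈ C.V | v ∉ C.edge i}, (N v)ᶜ,
      ∀ v ∈ C.V, v ∉ C.edge i → y ∉ N v := by
    intro y hy v hv hvi
    simp only [mem_iInter] at hy
    exact hy v ⟨hv, hvi⟩
  rintro x (⟨hx1, hx2, hx3⟩ | ⟨s, hs, rfl⟩ | ⟨v, hv, hvi, hx⟩)
  · filter_upwards [(C.isOpen_face x).mem_nhds (C.mem_face hx1), havoid x hx3] with y hy1 hy2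
    refine Or.inl ⟨C.face_subset _ hy1, ?_, hmem y hy2⟩
    rw [Bd, C.face_eq hy1]
    exact hx2
  · have h1 : (C.rest i)ᶜ ∈ 𝓝 (C.c s) := (C.isClosed_rest i).isOpen_compl.mem_nhds
      (Set.disjoint_left.1 (C.disjoint_arc_rest i) ⟨s, hs, rfl⟩)
    have h2 := havoid (C.c s) fun v hv hvi h => Set.disjoint_left.1 ((hN v hv).2 i hvi) h
      (C.arc_subset_edge i ⟨s, hs, rfl⟩)
    obtain ⟨ε, Ψ, hΨ, hsub⟩ := C.arcChart s (C.notMem_range_t hs) _ (Filter.inter_mem h1 h2)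
    have hε := hΨ.pos
    refine Filter.mem_of_superset hΨ.image_mem_nhds ?_
    rintro _ ⟨z, hz, rfl⟩
    have hz' := hsub ⟨z, hz, rfl⟩
    by_cases hzD : Ψ z ∈ range C.c
    · exact Or.inr (Or.inl (C.mem_arc_of_notMem_rest hzD hz'.1))
    · refine Or.inl ⟨hzD, C.bd_of_mem_closure hs ?_, hmem _ hz'.2⟩
      have := hΨ.mem_closure_face C hz hzD (x := 0) ⟨by linarith, hε.le⟩
      rwa [add_zero] at this
  · exact Filter.mem_of_superset (isOpen_interior.mem_nhds hx)
      fun y hy => Or.inr (Or.inr ⟨v, hv, hvi, hy⟩)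

/-- The sets `U` cover the space: every face has a boundary edge, and if the face meets a
distinguished neighbourhood of a double point, this edge can be chosen to end there. -/
lemma exists_mem_U [PreconnectedSpace X] {N : X → Set X} (hN : ∀ v ∈ C.V, N v ∈ 𝓝 v ∧
    ∀ x ∈ N v, x ∉ range C.c → ∃ i, v ∈ C.edge i ∧ C.Bd x i) (hdisj : C.V.PairwiseDisjoint N)
    (x : X) : ∃ i, x ∈ C.U N i := by
  by_cases hx : x ∈ range C.c
  · obtain ⟨s, rfl⟩ := hx
    obtain ⟨i, hi⟩ := C.exists_mem_Ico s
    exact ⟨i, C.mem_U_of_mem_Icc (fun v hv => (hN v hv).1) (Ico_subset_Icc_self hi)⟩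
  by_cases hxv : ∃ v ∈ C.V, x ∈ N v
  · obtain ⟨v, hv, hxv⟩ := hxv
    obtain ⟨i, hi, hB⟩ := (hN v hv).2 x hxv hx
    refine ⟨i, Or.inl ⟨hx, hB, fun w hw hwi hxw => ?_⟩⟩
    have : v = w := hdisj.elim hv hw (Set.not_disjoint_iff.2 ⟨x, hxv, hxw⟩)
    exact hwi (this ▸ hi)
  push Not at hxv
  suffices h : ∃ i, C.Bd x i by
    obtain ⟨i, hi⟩ := h
    exact ⟨i, Or.inl ⟨hx, hi, fun v hv _ => hxv v hv⟩⟩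
  have hfr : (frontier (C.face x)).Nonempty := by
    rw [nonempty_frontier_iff]
    refine ⟨⟨x, C.mem_face hx⟩, fun h => ?_⟩
    exact C.face_subset x (h ▸ mem_univ (C.c 0)) ⟨0, rfl⟩
  obtain ⟨y, hy⟩ := hfr
  obtain ⟨s, rfl⟩ := C.frontier_face_subset x hy
  obtain ⟨i, hi⟩ := C.exists_mem_Ico s
  rcases hi.1.eq_or_lt with h1 | h1
  · rw [← h1] at hy
    obtain ⟨hV1, hV2⟩ := hN _ (C.t_mem_V i)
    obtain ⟨z, hz1, hz2⟩ := mem_closure_iff_nhds.1 hy.1 _ hV1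
    obtain ⟨j, -, hj⟩ := hV2 z hz1 (C.face_subset _ hz2)
    refine ⟨j, ?_⟩
    rwa [Bd, C.face_eq hz2] at hj
  · exact ⟨i, C.bd_of_mem_closure ⟨h1, hi.2⟩ hy.1⟩

omit [LocallyConnectedSpace X] [T2Space X] in
lemma mem_edge_of_mem_U {N : X → Set X}
    (hN : ∀ v ∈ C.V, ∀ i, v ∉ C.edge i → Disjoint (N v) (C.edge i))
    (hdisj : C.V.PairwiseDisjoint N) {x v : X} (hv : v ∈ C.V) (hxv : x ∈ N v) {i : ℤ}
    (hx : x ∈ C.U N i) : v ∈ C.edge i := by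
  by_contra h
  rcases hx with ⟨-, -, hx⟩ | hx | ⟨w, hw, hwi, hxw⟩
  · exact hx v hv h hxv
  · exact Set.disjoint_left.1 (hN v hv i h) hxv (C.arc_subset_edge i hx)
  · have : v = w := hdisj.elim hv hw (Set.not_disjoint_iff.2 ⟨x, hxv, interior_subset hxw⟩)
    exact h (this ▸ hwi)

/-- Two edges ending at the same double point are close, if all pairs of edges with a common face
are: they either belong to the same branch, or bound a common corner. -/
lemma close_of_mem_edge (hn : 2 ≤ n)
    (hclose : ∀ x ∉ range C.c, ∀ i j, C.Bd x i → C.Bd x j → Close n i j) {v : X}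
    (hv : v ∈ C.V) {i j : ℤ} (hi : v ∈ C.edge i) (hj : v ∈ C.edge j) : Close n i j := by
  obtain ⟨k, hk, hik⟩ := C.exists_of_mem_V_of_mem_edge hv hi
  obtain ⟨l, hl, hjl⟩ := C.exists_of_mem_V_of_mem_edge hv hj
  by_cases h : ∃ m : ℤ, C.t k = C.t l + m
  · obtain ⟨m, hm⟩ := h
    rw [← C.t_add_mul] at hm
    have hkl := C.mono.injective hm
    refine ⟨m, ?_⟩
    have h1 : |i - j - 2 * n * m| ≤ 1 := by
      rw [abs_le]
      constructor <;> omega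
    omega
  · push Not at h
    obtain ⟨x, hx, h1, h2⟩ := C.exists_corner (hk.trans hl.symm) h hik hjl
    exact hclose x hx i j h1 h2

/-- Any two of the sets `U` that meet have close indices, if all pairs of edges with a common face
are close. -/
lemma close_of_mem_U (hn : 2 ≤ n)
    (hclose : ∀ x ∉ range C.c, ∀ i j, C.Bd x i → C.Bd x j → Close n i j) {N : X → Set X}
    (hN : ∀ v ∈ C.V, ∀ i, v ∉ C.edge i → Disjoint (N v) (C.edge i))
    (hdisj : C.V.PairwiseDisjoint N) {x : X} {i j : ℤ} (hi : x ∈ C.U N i) (hj : x ∈ C.U N j) :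
    Close n i j := by
  by_cases hxv : ∃ v ∈ C.V, x ∈ N v
  · obtain ⟨v, hv, hxv⟩ := hxv
    exact C.close_of_mem_edge hn hclose hv (C.mem_edge_of_mem_U hN hdisj hv hxv hi)
      (C.mem_edge_of_mem_U hN hdisj hv hxv hj)
  push Not at hxv
  rcases hi with ⟨hx, hi, -⟩ | hi | ⟨v, hv, -, h⟩
  · rcases hj with ⟨-, hj, -⟩ | hj | ⟨v, hv, -, h⟩
    · exact hclose x hx i j hi hj
    · exact absurd (image_subset_range _ _ hj) hx
    · exact absurd (interior_subset h) (hxv v hv)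
  · rcases hj with ⟨hx, -, -⟩ | hj | ⟨v, hv, -, h⟩
    · exact absurd (image_subset_range _ _ hi) hx
    · obtain ⟨s, hs, rfl⟩ := hi
      obtain ⟨s', hs', h⟩ := hj
      obtain ⟨k, hk⟩ := C.eq_add_int_of_mem_Ioo hs h.symm
      have h1 : C.t (i + 2 * n * k) < C.t (j + 1) := by
        rw [C.t_add_mul]; linarith [hs.1, hs'.2]
      have h2 : C.t j < C.t (i + 1 + 2 * n * k) := by
        rw [C.t_add_mul]; linarith [hs.2, hs'.1]
      have h3 := C.mono.lt_iff_lt.1 h1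
      have h4 := C.mono.lt_iff_lt.1 h2
      refine ⟨-k, ?_⟩
      rw [show i - j - 2 * (n : ℤ) * -k = i + 2 * n * k - j by ring,
        show i + 2 * (n : ℤ) * k - j = 0 by omega]
      simp only [abs_zero, mul_zero]
      omega
    · exact absurd (interior_subset h) (hxv v hv)
  · exact absurd (interior_subset h) (hxv v hv)

end CrossingCurve

/-! ### Two distant edges with a common face -/

lemma exists_continuous_pos_iff_mem {X : Type*} [MetricSpace X] {U : Set X} (hU : IsOpen U) :
    ∃ φ : X → ℝ, Continuous φ ∧ (∀ x, 0 ≤ φ x) ∧ ∀ x, 0 < φ x ↔ x ∈ U := by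
  rcases Uᶜ.eq_empty_or_nonempty with h | h
  · rw [compl_empty_iff] at h
    exact ⟨fun _ => 1, continuous_const, fun _ => zero_le_one, by simp [h]⟩
  · refine ⟨fun x => Metric.infDist x Uᶜ, Metric.continuous_infDist_pt _,
      fun _ => Metric.infDist_nonneg, fun x => ?_⟩
    rw [← hU.isClosed_compl.notMem_iff_infDist_pos h, notMem_compl_iff]

lemma exp_notMem_slitPlane {z : ℂ} {k : ℤ} (hz : z.im = (2 * k + 1) * Real.pi) :
    Complex.exp z ∉ Complex.slitPlane := by
  have h : (2 * (k : ℝ) + 1) * Real.pi = Real.pi + k * (2 * Real.pi) := by ring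
  rw [Complex.mem_slitPlane_iff, Complex.exp_re, Complex.exp_im, hz, h,
    Real.cos_add_int_mul_two_pi, Real.sin_add_int_mul_two_pi, Real.cos_pi, Real.sin_pi]
  have := Real.exp_pos z.re
  rintro (h1 | h1)
  · linarith
  · simp at h1

/-- If continuous functions without zeros have continuous logarithms along the curve, then
some face has two boundary edges whose indices are at least a third of the period apart. -/
theorem CrossingCurve.exists_not_close {X : Type*} [MetricSpace X] [LocallyConnectedSpace X]
    [PreconnectedSpace X] {n : ℕ} (C : CrossingCurve X n) (hn : 0 < n)
    (hlog : ∀ F : X → ℂ, Continuous F → (∀ x, F x ≠ 0) → ∃ g : ℝ → ℂ, Continuous g ∧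
      (∀ s, g (s + 1) = g s) ∧ ∀ s, Complex.exp (g s) = F (C.c s)) :
    ∃ x ∉ range C.c, ∃ i j, C.Bd x i ∧ C.Bd x j ∧ ¬ Close n i j := by
  by_contra! hclose
  rcases (show n = 1 ∨ 2 ≤ n by omega) with h1 | hn2
  · -- with one double point, the corners make both edges congruent modulo `2`
    subst h1
    obtain ⟨l, hl, hne⟩ := C.crossing 0
    obtain ⟨x, hx, hx1, hx2⟩ := C.exists_corner hl hne (Or.inl rfl) (Or.inl rfl)
    obtain ⟨y, hy, hy1, hy2⟩ := C.exists_corner hl hne (Or.inr rfl) (Or.inl rfl)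
    obtain ⟨a, ha⟩ := hclose x hx _ _ hx1 hx2
    obtain ⟨b, hb⟩ := hclose y hy _ _ hy1 hy2
    norm_num at ha hb
    have ha' := Int.abs_lt_one_iff.1 (show |-l - 2 * a| < 1 by omega)
    have hb' := Int.abs_lt_one_iff.1 (show |-1 - l - 2 * b| < 1 by omega)
    omega
  obtain ⟨N, hN, hdisj⟩ := C.exists_crossing_nhds hn
  have hcov := C.exists_mem_U (fun v hv => ⟨(hN v hv).2.1, (hN v hv).2.2.2⟩) hdisj
  have hcl : ∀ x i j, x ∈ C.U N i → x ∈ C.U N j → Close n i j := fun x i j =>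
    C.close_of_mem_U hn2 hclose (fun v hv => (hN v hv).2.2.1) hdisj
  have hU := C.isOpen_U hn (fun v hv => ⟨(hN v hv).1, (hN v hv).2.2.1⟩)
  have hφ : ∀ A : Set X, ∃ φ : X → ℝ, IsOpen A →
      Continuous φ ∧ (∀ x, 0 ≤ φ x) ∧ ∀ x, 0 < φ x ↔ x ∈ A := by
    intro A
    by_cases hA : IsOpen A
    · obtain ⟨φ, hφ⟩ := exists_continuous_pos_iff_mem hA
      exact ⟨φ, fun _ => hφ⟩
    · exact ⟨0, fun h => absurd h hA⟩
  choose φ hφ using hφ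
  -- the combination of the roots of unity by a (not normalized) partition of unity
  set F : X → ℂ := fun x => ∑ j ∈ Finset.Ico (0 : ℤ) (2 * n), (φ (C.U N j) x : ℂ) * unitPt n j
    with hF
  have hFc : Continuous F := by
    refine continuous_finsetSum _ fun j _ => ?_
    exact (Complex.continuous_ofReal.comp (hφ _ (hU j)).1).mul continuous_const
  have hslit : ∀ x i, x ∈ C.U N i → ∀ σ : ℝ, |σ| ≤ 1 / 2 →
      F x * unitPt n (-(i + σ)) ∈ Complex.slitPlane := by
    intro x i hi σ hσ
    refine sum_mul_unitPt_mem_slitPlane hn2 (fun j => φ (C.U N j) x)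
      (fun j => (hφ _ (hU j)).2.1 x) (fun j k => by rw [C.U_add_mul])
      (fun a b ha hb => hcl x a b (((hφ _ (hU a)).2.2 x).1 ha) (((hφ _ (hU b)).2.2 x).1 hb))
      (((hφ _ (hU i)).2.2 x).2 hi) hσ
  have hF0 : ∀ x, F x ≠ 0 := by
    intro x h0
    obtain ⟨i, hi⟩ := hcov x
    have := hslit x i hi 0 (by norm_num)
    rw [h0, zero_mul] at this
    exact Complex.zero_notMem_slitPlane this
  obtain ⟨g, hgc, hgp, hg⟩ := hlog F hFc hF0
  refine winding_contradiction hn C.mono C.add_period (y := fun s => (g s).im)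
    (Complex.continuous_im.comp hgc) (fun s => by simp only [hgp]) ?_
  intro i s hs σ hσ k hk
  have h1 := hslit (C.c s) i (C.mem_U_of_mem_Icc (fun v hv => (hN v hv).2.1) hs) σ hσ
  rw [← hg, unitPt, ← Complex.exp_add] at h1
  refine exp_notMem_slitPlane (k := k) ?_ h1
  rw [Complex.add_im, Complex.im_ofReal_mul, Complex.I_im, ← hk]
  ring

end KnotProj

namespace KnotProj

open Set Topology

/-! ### Edges as closures of components -/

namespace CrossingCurve

variable {X : Type*} [TopologicalSpace X] {n : ℕ} (C : CrossingCurve X n)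

lemma arc_subset_diff (i : ℤ) : C.arc i ⊆ range C.c \ C.V := by
  rintro _ ⟨s, hs, rfl⟩
  refine ⟨⟨s, rfl⟩, fun h => ?_⟩
  obtain ⟨_, ⟨j, rfl⟩, hj⟩ := h
  obtain ⟨k, hk⟩ := C.eq_add_int_of_mem_Ioo hs hj.symm
  refine C.notMem_range_t hs ⟨j + 2 * n * (-k), ?_⟩
  rw [C.t_add_mul, hk]
  push_cast
  ring

lemma mem_arc_of_mem_edge {x : X} {i : ℤ} (hx : x ∈ C.edge i) (hV : x ∉ C.V) : x ∈ C.arc i := by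
  obtain ⟨s, hs, rfl⟩ := hx
  refine ⟨s, ⟨lt_of_le_of_ne hs.1 ?_, lt_of_le_of_ne hs.2 ?_⟩, rfl⟩
  · rintro rfl
    exact hV (C.t_mem_V i)
  · rintro rfl
    exact hV (C.t_mem_V (i + 1))

lemma exists_mem_arc {x : X} (hx : x ∈ range C.c \ C.V) : ∃ i, x ∈ C.arc i := by
  obtain ⟨⟨s, rfl⟩, hV⟩ := hx
  obtain ⟨i, hi⟩ := C.exists_mem_Ico s
  exact ⟨i, C.mem_arc_of_mem_edge ⟨s, Ico_subset_Icc_self hi, rfl⟩ hV⟩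

lemma arc_nonempty (i : ℤ) : (C.arc i).Nonempty := (nonempty_Ioo.2 (C.t_lt i)).image _

lemma eq_add_mul_of_mem_Icc {i j : ℤ} {s : ℝ} (hs : s ∈ Ioo (C.t i) (C.t (i + 1)))
    (hj : C.c s ∈ C.edge j) : ∃ k : ℤ, j = i + 2 * n * k := by
  obtain ⟨s', hs', h⟩ := hj
  obtain ⟨k, hk⟩ := C.eq_add_int_of_mem_Ioo hs h.symm
  have h1 : C.t (i + 2 * n * k) < C.t (j + 1) := by
    rw [C.t_add_mul]; linarith [hs.1, hs'.2]
  have h2 : C.t j < C.t (i + 1 + 2 * n * k) := by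
    rw [C.t_add_mul]; linarith [hs.2, hs'.1]
  have h3 := C.mono.lt_iff_lt.1 h1
  have h4 := C.mono.lt_iff_lt.1 h2
  exact ⟨k, by omega⟩

lemma edge_eq_iff {i j : ℤ} : C.edge i = C.edge j ↔ (i : ZMod (2 * n)) = j := by
  rw [ZMod.intCast_eq_intCast_iff_dvd_sub]
  constructor
  · intro h
    obtain ⟨_, s, hs, rfl⟩ := C.arc_nonempty i
    obtain ⟨k, hk⟩ := C.eq_add_mul_of_mem_Icc hs
      (h ▸ C.arc_subset_edge i (mem_image_of_mem _ hs))
    exact ⟨k, by push_cast; rw [hk]; ring⟩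
  · rintro ⟨k, hk⟩
    have h : j = i + 2 * n * k := by push_cast at hk; linarith
    rw [h, C.edge_add_mul]

variable [T2Space X]

lemma closure_arc (i : ℤ) : closure (C.arc i) = C.edge i := by
  refine Subset.antisymm (closure_minimal (C.arc_subset_edge i) (C.isClosed_edge i)) ?_
  rw [edge, ← closure_Ioo (C.t_lt i).ne]
  exact image_closure_subset_closure_image C.continuous

lemma connectedComponentIn_eq_arc {i : ℤ} {x : X} (hx : x ∈ C.arc i) :
    connectedComponentIn (range C.c \ C.V) x = C.arc i := by
  refine Subset.antisymm ?_
    ((isPreconnected_Ioo.image _ C.continuous.continuousOn).subset_connectedComponentIn hx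
      (C.arc_subset_diff i))
  have hsub := connectedComponentIn_subset (range C.c \ C.V) x
  have h := isPreconnected_iff_subset_of_disjoint.1
    (isPreconnected_connectedComponentIn (F := range C.c \ C.V) (x := x)) (C.rest i)ᶜ (C.edge i)ᶜ
    (C.isClosed_rest i).isOpen_compl (C.isClosed_edge i).isOpen_compl
    (fun y hy => by
      by_contra h
      simp only [mem_union, mem_compl_iff, not_or, not_not] at h
      exact Set.disjoint_left.1 (C.disjoint_arc_rest i)
        (C.mem_arc_of_mem_edge h.2 (hsub hy).2) h.1)
    (by
      rw [eq_empty_iff_forall_notMem]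
      rintro y ⟨hy, hy1, hy2⟩
      exact hy2 (C.arc_subset_edge i (C.mem_arc_of_notMem_rest (hsub hy).1 hy1)))
  rcases h with h | h
  · exact fun y hy => C.mem_arc_of_notMem_rest (hsub hy).1 (h hy)
  · exact absurd (C.arc_subset_edge i hx)
      (h (mem_connectedComponentIn (C.arc_subset_diff i hx)))

lemma setOf_closure_connectedComponentIn :
    {I | ∃ x ∈ range C.c \ C.V, I = closure (connectedComponentIn (range C.c \ C.V) x)} =
      range C.edge := by
  ext I
  constructor
  · rintro ⟨x, hx, rfl⟩
    obtain ⟨i, hi⟩ := C.exists_mem_arc hx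
    exact ⟨i, by rw [C.connectedComponentIn_eq_arc hi, C.closure_arc]⟩
  · rintro ⟨i, rfl⟩
    obtain ⟨x, hx⟩ := C.arc_nonempty i
    exact ⟨x, C.arc_subset_diff i hx, by rw [C.connectedComponentIn_eq_arc hx, C.closure_arc]⟩

omit [T2Space X] in
/-- If two distinct edges together are traversed by one piece of the curve, then their indices are
successive modulo `2 * n`. -/
lemma index_succ_of_union_eq_image {i j : ℤ} (hij : C.edge i ≠ C.edge j) {a b : ℝ}
    (h : C.edge i ∪ C.edge j = C.c '' Icc a b) :
    ((j : ZMod (2 * n)) = i + 1) ∨ ((i : ZMod (2 * n)) = j + 1) := by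
  have hmid : ∀ i : ℤ, (C.t i + C.t (i + 1)) / 2 ∈ Ioo (C.t i) (C.t (i + 1)) := by
    intro i
    have := C.t_lt i
    constructor <;> linarith
  -- representatives of the two indices whose midpoints lie in the given parameter interval
  have hshift : ∀ i : ℤ, C.edge i ⊆ C.c '' Icc a b → ∃ i' : ℤ, (i' : ZMod (2 * n)) = i ∧
      (C.t i' + C.t (i' + 1)) / 2 ∈ Icc a b := by
    intro i hi
    obtain ⟨s, hs, hs'⟩ := hi (C.arc_subset_edge i (mem_image_of_mem _ (hmid i)))
    obtain ⟨k, hk⟩ := C.eq_add_int_of_mem_Ioo (hmid i) hs'.symm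
    refine ⟨i + 2 * n * k, ?_, ?_⟩
    · rw [← C.edge_eq_iff, C.edge_add_mul]
    · rw [show i + 2 * (n : ℤ) * k + 1 = i + 1 + 2 * n * k by ring, C.t_add_mul, C.t_add_mul]
      convert hs using 1
      rw [hk]; ring
  obtain ⟨i', hi', hia⟩ := hshift i (h ▸ subset_union_left)
  obtain ⟨j', hj', hja⟩ := hshift j (h ▸ subset_union_right)
  rw [Ne, C.edge_eq_iff, ← hi', ← hj'] at hij
  rw [← C.edge_eq_iff] at hi' hj'
  -- a piece of the curve that runs from arc `p` to a later arc traverses arc `p + 1`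
  have key : ∀ p q : ℤ, p < q → (C.t p + C.t (p + 1)) / 2 ∈ Icc a b →
      (C.t q + C.t (q + 1)) / 2 ∈ Icc a b → C.edge (p + 1) = C.edge i ∨
        C.edge (p + 1) = C.edge j := by
    intro p q hpq hp hq
    have h1 : (C.t (p + 1) + C.t (p + 1 + 1)) / 2 ∈ Icc a b := by
      have e1 := C.t_lt p
      have e2 := C.t_lt (p + 1)
      have e3 : C.t (p + 1) ≤ C.t q := C.mono.monotone (by omega)
      have e4 : C.t (p + 1 + 1) ≤ C.t (q + 1) := C.mono.monotone (by omega)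
      constructor <;> linarith [hp.1, hq.2]
    have h2 := mem_image_of_mem C.c h1
    rw [← h] at h2
    rcases h2 with h2 | h2
    · obtain ⟨k, hk⟩ := C.eq_add_mul_of_mem_Icc (hmid (p + 1)) h2
      left
      rw [hk, C.edge_add_mul]
    · obtain ⟨k, hk⟩ := C.eq_add_mul_of_mem_Icc (hmid (p + 1)) h2
      right
      rw [hk, C.edge_add_mul]
  -- since there are two different edges, the modulus is not `1`
  have hself : ∀ p q : ℤ, (p : ZMod (2 * n)) ≠ q → C.edge (p + 1) ≠ C.edge p := by
    intro p q hpq h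
    rw [C.edge_eq_iff] at h
    push_cast at h
    have h1 : (1 : ZMod (2 * n)) = 0 := by simpa using h
    exact hpq (by rw [← mul_one (p : ZMod (2 * n)), ← mul_one (q : ZMod (2 * n)), h1]; simp)
  rcases lt_or_gt_of_ne (show i' ≠ j' from fun h => hij (by rw [h])) with hlt | hlt
  · left
    rcases key i' j' hlt hia hja with h1 | h1
    · exact absurd (h1.trans hi'.symm) (hself i' j' hij)
    · rw [C.edge_eq_iff] at h1 hi'
      rw [← h1, ← hi']; push_cast; rfl
  · right
    rcases key j' i' hlt hja hia with h1 | h1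
    · rw [C.edge_eq_iff] at h1 hj'
      rw [← h1, ← hj']; push_cast; rfl
    · exact absurd (h1.trans hj'.symm) (hself j' i' (Ne.symm hij))

omit [T2Space X] in
lemma edge_union_edge_succ (i : ℤ) :
    C.edge i ∪ C.edge (i + 1) = C.c '' Icc (C.t i) (C.t (i + 1 + 1)) := by
  rw [edge, edge, ← image_union, Icc_union_Icc_eq_Icc (C.t_lt i).le (C.t_lt (i + 1)).le]

end CrossingCurve

/-! ### The cyclic distance -/

/-- The distance in the cycle graph on `ZMod N` is the greatest metric in which successive elements
have distance `1`. -/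
lemma isGreatest_natAbs_valMinAbs {E : Type*} {N : ℕ} (hN : 2 ≤ N) (e : E → ZMod N)
    (he : Function.Bijective e) (A : E → E → Prop)
    (hA : ∀ I J, A I J ↔ e J = e I + 1 ∨ e I = e J + 1) :
    IsGreatest {d : E → E → ℝ | (∀ I J, d I J = 0 ↔ I = J) ∧ (∀ I J, d I J = d J I) ∧
      (∀ I J L, d I L ≤ d I J + d J L) ∧ ∀ I J, A I J → d I J = 1}
      (fun I J => ((e I - e J).valMinAbs.natAbs : ℝ)) := by
  have : NeZero N := ⟨by omega⟩
  have hone : (1 : ZMod N).valMinAbs.natAbs = 1 := by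
    have h := ZMod.valMinAbs_natCast_of_le_half (n := N) (a := 1) (by omega)
    rw [Nat.cast_one] at h
    rw [h]
    rfl
  refine ⟨⟨fun I J => ?_, fun I J => ?_, fun I J L => ?_, fun I J h => ?_⟩, ?_⟩
  · rw [Nat.cast_eq_zero, Int.natAbs_eq_zero, ZMod.valMinAbs_eq_zero, sub_eq_zero, he.1.eq_iff]
  · beta_reduce
    rw [← ZMod.natAbs_valMinAbs_neg, neg_sub]
  · have h := (ZMod.natAbs_valMinAbs_add_le (e I - e J) (e J - e L)).trans (Int.natAbs_add_le _ _)
    rw [sub_add_sub_cancel] at h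
    beta_reduce
    exact_mod_cast h
  · beta_reduce
    rcases (hA I J).1 h with h | h
    · rw [← ZMod.natAbs_valMinAbs_neg, h]
      simp [hone]
    · rw [h]
      simp [hone]
  · rintro d ⟨h0, hsymm, htri, hadj⟩ I J
    have key : ∀ (m : ℕ) (I J : E), e J = e I + m → d I J ≤ m := by
      intro m
      induction m with
      | zero =>
        intro I J h
        rw [Nat.cast_zero, add_zero] at h
        simp [(h0 I J).2 (he.1 h).symm]
      | succ m ih =>
        intro I J h
        obtain ⟨L, hL⟩ := he.2 (e I + m)
        have h1 := hadj L J ((hA L J).2 (Or.inl (by rw [h, hL]; push_cast; ring)))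
        push_cast
        linarith [htri I L J, ih I L hL]
    change d I J ≤ ((e I - e J).valMinAbs.natAbs : ℝ)
    have hv := ZMod.coe_valMinAbs (e I - e J)
    set v := (e I - e J).valMinAbs
    rcases Int.natAbs_eq v with h | h
    · rw [hsymm]
      apply key
      rw [h, Int.cast_natCast] at hv
      linear_combination -hv
    · apply key
      rw [h, Int.cast_neg, Int.cast_natCast] at hv
      linear_combination hv

/-- Edges that are not close have cyclic distance at least `2 * n / 3`. -/
lemma le_natAbs_valMinAbs_of_not_close {n : ℕ} {i j : ℤ} (h : ¬ Close n i j) :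
    2 * (n : ℝ) / 3 ≤ ((i - j : ZMod (2 * n)).valMinAbs.natAbs : ℝ) := by
  have hv := ZMod.coe_valMinAbs ((i - j : ℤ) : ZMod (2 * n))
  rw [Int.cast_sub] at hv
  set v := (i - j : ZMod (2 * n)).valMinAbs
  rw [← Int.cast_sub, ZMod.intCast_eq_intCast_iff_dvd_sub] at hv
  obtain ⟨k, hk⟩ := hv
  have h1 : ¬ 3 * |v| < 2 * n := fun h' => h ⟨k, by
    rwa [show i - j - 2 * n * k = v by push_cast at hk; linarith]⟩
  rw [not_lt, Int.abs_eq_natAbs] at h1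
  have h2 : (2 * n : ℝ) ≤ 3 * v.natAbs := by exact_mod_cast h1
  linarith

end KnotProj

namespace KnotProj

open Set Topology Module

/-! ### Local models from the inverse function theorem -/

lemma closedBall_zero_eq_square (ε : ℝ) :
    Metric.closedBall (0 : ℝ × ℝ) ε = Icc (-ε) ε ×ˢ Icc (-ε) ε := by
  rw [← Prod.mk_zero_zero, ← closedBall_prod_same, Real.closedBall_eq_Icc, zero_sub, zero_add]

/-- A `1`-periodic curve that comes close to a point does so only at parameters close to those at
which it passes through the point. -/
lemma exists_nhds_forall_mem {P : Type*} [TopologicalSpace P] [T2Space P] {σ : ℝ → P}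
    (hσ : Continuous σ) (hper : ∀ s, σ (s + 1) = σ s)
    {W : Set ℝ} (hW : IsOpen W) (hWper : ∀ (u : ℝ) (k : ℤ), u + k ∈ W → u ∈ W) {v : P}
    (hv : ∀ u, σ u = v → u ∈ W) : ∃ O ∈ 𝓝 v, ∀ u, σ u ∈ O → u ∈ W := by
  have hK : IsClosed (σ '' (Icc 0 1 \ W)) :=
    ((isCompact_Icc.diff hW).image hσ).isClosed
  refine ⟨(σ '' (Icc 0 1 \ W))ᶜ, hK.isOpen_compl.mem_nhds ?_, fun u hu => ?_⟩
  · rintro ⟨u, hu, huv⟩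
    exact hu.2 (hv u huv)
  · by_contra h
    refine hu ⟨u + (-⌊u⌋ : ℤ), ⟨⟨?_, ?_⟩, fun h' => h (hWper _ _ h')⟩, ?_⟩
    · push_cast; linarith [Int.floor_le u]
    · push_cast; linarith [Int.lt_floor_add_one u]
    · have h : Function.Periodic σ 1 := hper
      simpa using h.int_mul (-⌊u⌋) u

section Plane

variable {P : Type*} [NormedAddCommGroup P] [NormedSpace ℝ P] [FiniteDimensional ℝ P]

/-- The sum of two curves in a plane with independent velocities is a local homeomorphism. -/
lemma exists_strictFDerivAt_add (hP : finrank ℝ P = 2) {σ τ : ℝ → P} (hσ : ContDiff ℝ 1 σ)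
    (hτ : ContDiff ℝ 1 τ) {s : ℝ} (hli : LinearIndependent ℝ ![deriv σ s, deriv τ 0]) :
    ∃ L : (ℝ × ℝ) ≃L[ℝ] P,
      HasStrictFDerivAt (fun z : ℝ × ℝ => σ (s + z.1) + τ z.2) (L : ℝ × ℝ →L[ℝ] P) 0 := by
  have h1 : HasStrictFDerivAt (fun z : ℝ × ℝ => σ (s + z.1))
      ((ContinuousLinearMap.fst ℝ ℝ ℝ).smulRight (deriv σ s)) 0 := by
    have hd : HasStrictDerivAt σ (deriv σ s) (s + (0 : ℝ × ℝ).1) := by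
      rw [Prod.fst_zero, add_zero]
      exact hσ.contDiffAt.hasStrictDerivAt one_ne_zero
    have hf : HasStrictFDerivAt (fun z : ℝ × ℝ => s + z.1) (ContinuousLinearMap.fst ℝ ℝ ℝ) 0 :=
      hasStrictFDerivAt_fst.const_add s
    exact (hd.hasStrictFDerivAt.comp (0 : ℝ × ℝ) hf).congr_fderiv (by ext <;> simp)
  have h2 : HasStrictFDerivAt (fun z : ℝ × ℝ => τ z.2)
      ((ContinuousLinearMap.snd ℝ ℝ ℝ).smulRight (deriv τ 0)) 0 := by
    have hd : HasStrictDerivAt τ (deriv τ 0) ((0 : ℝ × ℝ).2) :=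
      hτ.contDiffAt.hasStrictDerivAt one_ne_zero
    have hf : HasStrictFDerivAt (fun z : ℝ × ℝ => z.2) (ContinuousLinearMap.snd ℝ ℝ ℝ) 0 :=
      hasStrictFDerivAt_snd
    exact (hd.hasStrictFDerivAt.comp (0 : ℝ × ℝ) hf).congr_fderiv (by ext <;> simp)
  set M : ℝ × ℝ →L[ℝ] P := (ContinuousLinearMap.fst ℝ ℝ ℝ).smulRight (deriv σ s) +
    (ContinuousLinearMap.snd ℝ ℝ ℝ).smulRight (deriv τ 0) with hM
  have hinj : Function.Injective (M : ℝ × ℝ →ₗ[ℝ] P) := by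
    rw [← LinearMap.ker_eq_bot, LinearMap.ker_eq_bot']
    rintro ⟨x, y⟩ h
    have h' : x • deriv σ s + y • deriv τ 0 = 0 := by simpa [hM] using h
    obtain ⟨rfl, rfl⟩ := LinearIndependent.pair_iff.1 hli x y h'
    rfl
  let e : (ℝ × ℝ) ≃ₗ[ℝ] P := LinearMap.linearEquivOfInjective (M : ℝ × ℝ →ₗ[ℝ] P) hinj
    (by rw [hP]; simp)
  refine ⟨e.toContinuousLinearEquiv, (h1.add h2).congr_fderiv ?_⟩
  ext <;> rfl

/-- Near `σ s`, the map `(x, y) ↦ σ (s + x) + τ y` on a small square is a chart in which the curve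
`σ` is contained in the axes, provided that all passages of `σ` through `σ s` run along the
axes. -/
lemma exists_square (hP : finrank ℝ P = 2) {σ τ : ℝ → P} (hσ : ContDiff ℝ 1 σ)
    (hτ : ContDiff ℝ 1 τ) (hper : ∀ s, σ (s + 1) = σ s) {s : ℝ} (hτ0 : τ 0 = 0)
    (hli : LinearIndependent ℝ ![deriv σ s, deriv τ 0]) (B : Set ℝ)
    (hB : ∀ u, σ u = σ s → (∃ k : ℤ, u = s + k) ∨ ∃ b ∈ B, ∃ k : ℤ, u = b + k)
    (hBτ : ∀ b ∈ B, ∀ y, σ s + τ y = σ (b + y)) {O : Set P} (hO : O ∈ 𝓝 (σ s)) :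
    ∃ ε > 0, (fun z : ℝ × ℝ => σ (s + z.1) + τ z.2) '' (Icc (-ε) ε ×ˢ Icc (-ε) ε) ∈ 𝓝 (σ s) ∧
      (fun z : ℝ × ℝ => σ (s + z.1) + τ z.2) '' (Icc (-ε) ε ×ˢ Icc (-ε) ε) ⊆ O ∧
      ∀ z ∈ Icc (-ε) ε ×ˢ Icc (-ε) ε, σ (s + z.1) + τ z.2 ∈ range σ →
        z.2 = 0 ∨ (z.1 = 0 ∧ B.Nonempty) := by
  obtain ⟨L, hL⟩ := exists_strictFDerivAt_add hP hσ hτ hli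
  set Φ : ℝ × ℝ → P := fun z => σ (s + z.1) + τ z.2 with hΦ
  have hΦ0 : Φ 0 = σ s := by simp [hΦ, hτ0]
  have hΦc : Continuous Φ := by
    have := hσ.continuous
    have := hτ.continuous
    fun_prop
  set e := hL.toOpenPartialHomeomorph Φ with he
  have hsrc : e.source ∈ 𝓝 (0 : ℝ × ℝ) :=
    e.open_source.mem_nhds hL.mem_toOpenPartialHomeomorph_source
  obtain ⟨δ, hδ, hδs⟩ := Metric.nhds_basis_closedBall.mem_iff.1 hsrc
  have hinj : InjOn Φ (Metric.closedBall 0 δ) := e.injOn.mono hδs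
  rw [closedBall_zero_eq_square] at hinj
  -- close to `σ s`, only parameters close to those of the branches through `σ s` occur, and there
  -- injectivity of `Φ` puts the curve on the axes
  obtain ⟨O', hO', hW⟩ := exists_nhds_forall_mem hσ.continuous hper (v := σ s)
    (W := {u | (∃ k : ℤ, |u - s - k| < δ) ∨ ∃ b ∈ B, ∃ k : ℤ, |u - b - k| < δ})
    (by
      simp only [ofPred_or, ofPred_exists, ← exists_prop]
      refine IsOpen.union (isOpen_iUnion fun k => ?_) (isOpen_iUnion fun b =>
        isOpen_iUnion fun _ => isOpen_iUnion fun k => ?_) <;>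
      exact isOpen_lt (by fun_prop) continuous_const)
    (by
      rintro u k (⟨j, hj⟩ | ⟨b, hb, j, hj⟩)
      · exact Or.inl ⟨j - k, by push_cast; rwa [show u - s - (j - k) = u + k - s - j by ring]⟩
      · exact Or.inr ⟨b, hb, j - k, by
          push_cast; rwa [show u - b - (j - k) = u + k - b - j by ring]⟩)
    (by
      intro u hu
      rcases hB u hu with ⟨k, rfl⟩ | ⟨b, hb, k, rfl⟩
      · exact Or.inl ⟨k, by simpa using hδ⟩
      · exact Or.inr ⟨b, hb, k, by simpa using hδ⟩)
  have hpre : Φ ⁻¹' (O ∩ O') ∩ Metric.closedBall 0 δ ∈ 𝓝 (0 : ℝ × ℝ) := by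
    refine Filter.inter_mem (hΦc.continuousAt.preimage_mem_nhds ?_) (Metric.closedBall_mem_nhds _ hδ)
    rw [hΦ0]
    exact Filter.inter_mem hO hO'
  obtain ⟨ε, hε, hεs⟩ := Metric.nhds_basis_closedBall.mem_iff.1 hpre
  have hnhds : Φ '' Metric.closedBall 0 ε ∈ 𝓝 (σ s) := by
    rw [← hΦ0, ← hL.map_nhds_eq_of_equiv]
    exact Filter.image_mem_map (Metric.closedBall_mem_nhds _ hε)
  rw [closedBall_zero_eq_square] at hεs hnhds
  rw [closedBall_zero_eq_square] at hεs
  refine ⟨ε, hε, hnhds, ?_, ?_⟩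
  · rintro _ ⟨z, hz, rfl⟩
    exact (hεs hz).1.1
  · rintro z hz ⟨u, hu⟩
    have hz0 : (0 : ℝ) ∈ Icc (-δ) δ := ⟨by linarith, hδ.le⟩
    have hσper : ∀ (x : ℝ) (k : ℤ), σ (x + k) = σ x := by
      intro x k
      have h : Function.Periodic σ 1 := hper
      simpa using h.int_mul k x
    rcases hW u (hu ▸ (hεs hz).1.2) with ⟨k, hk⟩ | ⟨b, hb, k, hk⟩
    · left
      have h1 : Φ (u - s - k, 0) = Φ z := by
        simp only [hΦ, hτ0, add_zero]
        rw [← hu, ← hσper _ k]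
        congr 1
        ring
      rw [← hinj ⟨abs_le.1 hk.le, hz0⟩ (hεs hz).2 h1]
    · right
      have h1 : Φ (0, u - b - k) = Φ z := by
        simp only [hΦ, add_zero]
        rw [hBτ b hb, ← hu, ← hσper _ k]
        congr 1
        ring
      rw [← hinj ⟨hz0, abs_le.1 hk.le⟩ (hεs hz).2 h1]
      exact ⟨rfl, b, hb⟩

variable {X : Type*} [TopologicalSpace X] {ι : P → X}

/-- A plane curve has local models near each parameter where it is an embedded immersion; `ι`
transports them to another surface. -/
lemma exists_isArcChart (hι : IsOpenEmbedding ι) (hP : finrank ℝ P = 2) {σ : ℝ → P}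
    (hσ : ContDiff ℝ 1 σ) (hper : ∀ s, σ (s + 1) = σ s) {s : ℝ} (hd : deriv σ s ≠ 0)
    (hB : ∀ u, σ u = σ s → ∃ k : ℤ, u = s + k) {O : Set X} (hO : O ∈ 𝓝 (ι (σ s))) :
    ∃ ε Ψ, IsArcChart (fun u => ι (σ u)) s ε Ψ ∧ Ψ '' (Icc (-ε) ε ×ˢ Icc (-ε) ε) ⊆ O := by
  obtain ⟨m, hm⟩ := exists_linearIndependent_pair_of_one_lt_finrank (by omega : 1 < finrank ℝ P) hd
  obtain ⟨ε, hε, h1, h2, h3⟩ := exists_square hP hσ (τ := fun y => y • m) (by fun_prop) hper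
    (by simp) (by
      have : deriv (fun y : ℝ => y • m) 0 = m := by
        simpa using ((hasDerivAt_id (0 : ℝ)).smul_const m).deriv
      rwa [this]) ∅ (fun u hu => Or.inl (hB u hu)) (by simp)
    (hι.continuous.continuousAt.preimage_mem_nhds hO)
  refine ⟨ε, fun z => ι (σ (s + z.1) + z.2 • m), ⟨hε, ?_, ?_, ?_, ?_⟩, ?_⟩
  · have := hσ.continuous
    have := hι.continuous
    fun_prop
  · have := hι.isOpenMap.image_mem_nhds h1
    rwa [image_image] at this
  · intro x _
    simp
  · rintro z hz ⟨u, hu⟩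
    rcases h3 z hz ⟨u, hι.injective hu⟩ with h | h
    · exact h
    · exact absurd h.2 not_nonempty_empty
  · rintro _ ⟨z, hz, rfl⟩
    exact h2 ⟨z, hz, rfl⟩

/-- A plane curve has local models at each transversal double point; `ι` transports them to another
surface. -/
lemma exists_isCrossChart (hι : IsOpenEmbedding ι) (hP : finrank ℝ P = 2) {σ : ℝ → P}
    (hσ : ContDiff ℝ 1 σ) (hper : ∀ s, σ (s + 1) = σ s) {s s' : ℝ} (hss' : σ s = σ s')
    (hd : LinearIndependent ℝ ![deriv σ s, deriv σ s'])
    (hB : ∀ u, σ u = σ s → (∃ k : ℤ, u = s + k) ∨ ∃ k : ℤ, u = s' + k)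
    {O : Set X} (hO : O ∈ 𝓝 (ι (σ s))) :
    ∃ ε Ψ, IsCrossChart (fun u => ι (σ u)) s s' ε Ψ ∧
      Ψ '' (Icc (-ε) ε ×ˢ Icc (-ε) ε) ⊆ O := by
  obtain ⟨ε, hε, h1, h2, h3⟩ := exists_square hP hσ (τ := fun y => σ (s' + y) - σ s')
    (by fun_prop) hper (by simp) (by
      have : deriv (fun y : ℝ => σ (s' + y) - σ s') 0 = deriv σ s' := by
        rw [deriv_sub_const, deriv_comp_const_add, add_zero]
      rwa [this]) {s'} (fun u hu => by simpa using hB u hu) (by simp [hss'])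
    (hι.continuous.continuousAt.preimage_mem_nhds hO)
  refine ⟨ε, fun z => ι (σ (s + z.1) + (σ (s' + z.2) - σ s')), ⟨hε, ?_, ?_, ?_, ?_, ?_⟩, ?_⟩
  · have := hσ.continuous
    have := hι.continuous
    fun_prop
  · have := hι.isOpenMap.image_mem_nhds h1
    rwa [image_image] at this
  · intro x _
    simp
  · intro y _
    simp [hss']
  · rintro z hz ⟨u, hu⟩
    rcases h3 z hz ⟨u, hι.injective hu⟩ with h | h
    · exact Or.inr h
    · exact Or.inl h.1
  · rintro _ ⟨z, hz, rfl⟩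
    exact h2 ⟨z, hz, rfl⟩

end Plane

/-! ### Enumeration of a periodic discrete set -/

/-- The reals whose fractional part lies in a given finite set can be enumerated increasingly. -/
lemma exists_strictMono_enumeration {A : Finset ℝ} (hA : ∀ a ∈ A, a ∈ Ico (0 : ℝ) 1) {N : ℕ}
    (hN : 0 < N) (hcard : A.card = N) : ∃ t : ℤ → ℝ, StrictMono t ∧ (∀ i, t (i + N) = t i + 1) ∧
      ∀ s, s ∈ range t ↔ Int.fract s ∈ A := by
  have hNZ : (0 : ℤ) < N := by exact_mod_cast hN
  have hlt : ∀ i : ℤ, (i % N).toNat < N := fun i => by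
    have := Int.emod_lt_of_pos i hNZ
    have := Int.emod_nonneg i hNZ.ne'
    omega
  let e := A.orderEmbOfFin hcard
  have hemem : ∀ j, e j ∈ A := fun j => A.orderEmbOfFin_mem hcard j
  -- the increasing enumeration of `A`, continued periodically
  let t : ℤ → ℝ := fun i => e ⟨(i % N).toNat, hlt i⟩ + (i / N : ℤ)
  refine ⟨t, strictMono_int_of_lt_succ fun i => ?_, fun i => ?_, fun s => ⟨?_, ?_⟩⟩
  · have hd := Int.emod_add_mul_ediv i N
    have hd' := Int.emod_add_mul_ediv (i + 1) N
    have h0 := Int.emod_nonneg i hNZ.ne'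
    have h1 := Int.emod_lt_of_pos i hNZ
    by_cases h : i % N + 1 < N
    · have hm : (i + 1) % N = i % N + 1 := by
        rw [Int.add_emod, Int.emod_eq_of_lt (a := i % N + 1 % N)] <;>
        rw [Int.emod_eq_of_lt (a := 1)] <;> omega
      have hq : (i + 1) / N = i / N := by
        have h2 : (N : ℤ) * ((i + 1) / N) = N * (i / N) := by omega
        exact mul_left_cancel₀ hNZ.ne' h2
      simp only [t, hq]
      refine add_lt_add_left (e.strictMono ?_) _
      rw [Fin.mk_lt_mk]
      omega
    · have hm : (i + 1) % N = 0 := by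
        apply Int.emod_eq_zero_of_dvd
        refine ⟨i / N + 1, ?_⟩
        rw [mul_add, mul_one]
        omega
      have hq : (i + 1) / N = i / N + 1 := by
        have h2 : (N : ℤ) * ((i + 1) / N) = N * (i / N + 1) := by
          rw [mul_add, mul_one]
          omega
        exact mul_left_cancel₀ hNZ.ne' h2
      simp only [t, hq]
      push_cast
      linarith [(hA _ (hemem ⟨(i % N).toNat, hlt i⟩)).2,
        (hA _ (hemem ⟨((i + 1) % N).toNat, hlt (i + 1)⟩)).1]
  · simp only [t, Int.add_emod_right, Int.add_ediv_of_dvd_right (dvd_refl (N : ℤ)),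
      Int.ediv_self hNZ.ne']
    push_cast
    ring
  · rintro ⟨i, rfl⟩
    simp only [t]
    rw [Int.fract_add_intCast, Int.fract_eq_self.2 (hA _ (hemem _))]
    exact hemem _
  · intro hs
    have hr : Int.fract s ∈ range e := by
      rw [Finset.range_orderEmbOfFin]
      exact hs
    obtain ⟨⟨j, hj⟩, hej⟩ := hr
    have hjZ : (j : ℤ) < N := by exact_mod_cast hj
    refine ⟨j + N * ⌊s⌋, ?_⟩
    have hm : ((j : ℤ) + N * ⌊s⌋) % N = j := by
      rw [Int.add_mul_emod_self_left, Int.emod_eq_of_lt (by omega) hjZ]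
    have hq : ((j : ℤ) + N * ⌊s⌋) / N = ⌊s⌋ := by
      rw [Int.add_mul_ediv_left _ _ hNZ.ne', Int.ediv_eq_zero_of_lt (by omega) hjZ, zero_add]
    simp only [t, hm, hq, Int.toNat_natCast]
    rw [hej, Int.fract_add_floor]

end KnotProj

namespace KnotProj

open Set Topology Module

/-! ### From the knot projection to a labelled curve -/

lemma finrank_E3 : Fact (finrank ℝ E3 = 2 + 1) := ⟨by simp⟩

lemma locallyConnectedSpace_S2 : LocallyConnectedSpace S2 :=
  have := finrank_E3
  ChartedSpace.locallyConnectedSpace (EuclideanSpace ℝ (Fin 2)) S2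

lemma preconnectedSpace_S2 : PreconnectedSpace S2 :=
  isPreconnected_iff_preconnectedSpace.1 (isPreconnected_sphere (by
    rw [← finrank_eq_rank, finrank_E3.out]; norm_num) 0 1)

lemma coe_eq_coe_iff {s s' : ℝ} : (s : UnitAddCircle) = s' ↔ ∃ k : ℤ, s' = s + k := by
  rw [eq_comm, ← sub_eq_zero, ← AddCircle.coe_sub, AddCircle.coe_eq_zero_iff]
  refine exists_congr fun k => ?_
  rw [zsmul_one]
  constructor <;> intro h <;> linarith

namespace SmoothKnot

variable (K : SmoothKnot)

/-- The projected knot as a `1`-periodic curve in the sphere. -/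
def path (t : ℝ) : S2 := K.proj (t : UnitAddCircle)

lemma range_path : range K.path = K.diagram := by
  ext x
  constructor
  · rintro ⟨t, rfl⟩
    exact ⟨_, rfl⟩
  · rintro ⟨θ, rfl⟩
    obtain ⟨t, rfl⟩ := QuotientAddGroup.mk_surjective θ
    exact ⟨t, rfl⟩

lemma path_add_one (s : ℝ) : K.path (s + 1) = K.path s := by
  rw [path, path, (coe_eq_coe_iff (s := s) (s' := s + 1)).2 ⟨1, by simp⟩]

lemma contDiff_curve : ContDiff ℝ 1 K.curve := K.smooth.fst

lemma continuous_path : Continuous K.path :=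
  continuous_induced_rng.2 K.contDiff_curve.continuous

lemma path_mem_doublePoints_iff {s : ℝ} : K.path s ∈ K.doublePoints ↔
    ∃ s' : ℝ, (s : UnitAddCircle) ≠ s' ∧ K.path s = K.path s' := by
  constructor
  · rintro ⟨θ, φ, hne, hθ, hφ⟩
    obtain ⟨a, rfl⟩ := QuotientAddGroup.mk_surjective θ
    obtain ⟨b, rfl⟩ := QuotientAddGroup.mk_surjective φ
    by_cases h : (s : UnitAddCircle) = a
    · exact ⟨b, fun h' => hne (h.symm.trans h'), hφ.symm⟩
    · exact ⟨a, h, hθ.symm⟩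
  · rintro ⟨s', hne, h⟩
    exact ⟨s, s', hne, rfl, h.symm⟩

/-- The projection of a knot is not the whole sphere: its image under a linear projection to a plane
is a `C¹` curve and therefore misses a point of the unit disc. -/
lemma exists_notMem_diagram : ∃ p : S2, p ∉ K.diagram := by
  have hc : ContDiff ℝ 1 (fun t : ℝ => (fun i : Fin 2 => K.curve t i.castSucc)) := by
    rw [contDiff_pi]
    intro i
    exact (EuclideanSpace.proj (𝕜 := ℝ) i.castSucc : E3 →L[ℝ] ℝ).contDiff.comp K.contDiff_curve
  have hd := hc.dense_compl_range_of_finrank_lt_finrank (by simp)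
  obtain ⟨y, hy1, hy2⟩ := hd.inter_open_nonempty {y : Fin 2 → ℝ | y 0 ^ 2 + y 1 ^ 2 < 1}
    (isOpen_lt (by fun_prop) continuous_const) ⟨0, by simp⟩
  have hy1' : y 0 ^ 2 + y 1 ^ 2 < 1 := hy1
  have hnorm : ‖(!₂[y 0, y 1, √(1 - (y 0 ^ 2 + y 1 ^ 2))] : E3)‖ = 1 := by
    rw [EuclideanSpace.norm_eq, Fin.sum_univ_three, Real.sqrt_eq_one]
    simp only [Real.norm_eq_abs, sq_abs]
    simp [Real.sq_sqrt (show 0 ≤ 1 - (y 0 ^ 2 + y 1 ^ 2) by linarith)]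
  refine ⟨⟨!₂[y 0, y 1, √(1 - (y 0 ^ 2 + y 1 ^ 2))], by simpa using hnorm⟩, fun h => ?_⟩
  rw [← K.range_path] at h
  obtain ⟨t, ht⟩ := h
  refine hy2 ⟨t, ?_⟩
  have h1 : K.curve t = !₂[y 0, y 1, √(1 - (y 0 ^ 2 + y 1 ^ 2))] := congrArg Subtype.val ht
  ext i
  simp only [h1]
  fin_cases i <;> simp

section Stereographic

variable {K} {p : S2}

lemma norm_coe (p : S2) : ‖(p : E3)‖ = 1 := norm_eq_of_mem_sphere p

variable (K p) in
/-- The projected knot seen in the plane, by stereographic projection from `p`. -/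
noncomputable def planeCurve (t : ℝ) : (ℝ ∙ (p : E3))ᗮ := stereoToFun (p : E3) (K.curve t)

lemma contDiff_planeCurve (hp : p ∉ K.diagram) : ContDiff ℝ 1 (K.planeCurve p) := by
  refine contDiffOn_stereoToFun.comp_contDiff K.contDiff_curve fun t h => hp ?_
  have h' : inner ℝ (p : E3) (K.path t : E3) = (1 : ℝ) := h
  rw [inner_eq_one_iff_of_norm_eq_one (norm_coe p) (norm_coe (K.path t))] at h'
  exact ⟨t, Subtype.ext h'.symm⟩

lemma stereoInvFun_planeCurve (hp : p ∉ K.diagram) (t : ℝ) :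
    stereoInvFun (norm_coe p) (K.planeCurve p t) = K.path t := by
  refine stereo_left_inv (norm_coe p) (x := K.path t) fun h => hp ?_
  exact ⟨t, Subtype.ext h⟩

lemma planeCurve_eq_iff (hp : p ∉ K.diagram) {s t : ℝ} :
    K.planeCurve p s = K.planeCurve p t ↔ K.path s = K.path t := by
  constructor
  · intro h
    rw [← stereoInvFun_planeCurve hp, h, stereoInvFun_planeCurve hp]
  · intro h
    have h' : K.curve s = K.curve t := congrArg Subtype.val h
    rw [planeCurve, planeCurve, h']

lemma isOpenEmbedding_stereoInvFun : IsOpenEmbedding (stereoInvFun (norm_coe p)) :=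
  isOpenEmbedding_stereographic_symm (norm_coe p)

/-- Velocities of the curve in the sphere are the images of velocities of the plane curve under the
derivative of the inverse stereographic projection. -/
lemma deriv_curve (hp : p ∉ K.diagram) (t : ℝ) : deriv K.curve t =
    fderiv ℝ (fun w : (ℝ ∙ (p : E3))ᗮ => stereoInvFunAux (p : E3) w) (K.planeCurve p t)
      (deriv (K.planeCurve p) t) := by
  have h1 : K.curve = (fun w : (ℝ ∙ (p : E3))ᗮ => stereoInvFunAux (p : E3) w) ∘
      K.planeCurve p := by
    funext s
    exact (congrArg Subtype.val (stereoInvFun_planeCurve hp s)).symm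
  have h2 : ContDiff ℝ 1 (fun w : (ℝ ∙ (p : E3))ᗮ => stereoInvFunAux (p : E3) w) :=
    contDiff_stereoInvFunAux.comp (ℝ ∙ (p : E3))ᗮ.subtypeL.contDiff
  rw [h1, fderiv_comp_deriv]
  · exact h2.differentiable one_ne_zero _
  · exact (contDiff_planeCurve hp).differentiable one_ne_zero _

/-- A continuous function without zeros on the sphere has a continuous logarithm along a curve that
is not the whole sphere, because the complement of a point is simply connected. -/
lemma exists_continuous_log (hp : p ∉ K.diagram) (F : S2 → ℂ) (hF : Continuous F)
    (hF0 : ∀ x, F x ≠ 0) : ∃ g : ℝ → ℂ, Continuous g ∧ (∀ s, g (s + 1) = g s) ∧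
      ∀ s, Complex.exp (g s) = F (K.path s) := by
  obtain ⟨f, ⟨-, hf⟩, -⟩ := Complex.isCoveringMapOn_exp.existsUnique_continuousMap_lifts
    ⟨fun w : (ℝ ∙ (p : E3))ᗮ => F (stereoInvFun (norm_coe p) w),
      hF.comp (continuous_stereoInvFun (norm_coe p))⟩ (a₀ := 0)
    (Complex.exp_log (hF0 (stereoInvFun (norm_coe p) 0))) (fun w => hF0 _)
  refine ⟨fun s => f (K.planeCurve p s), f.continuous.comp (contDiff_planeCurve hp).continuous,
    fun s => ?_, fun s => ?_⟩
  · exact congrArg f ((planeCurve_eq_iff hp).2 (K.path_add_one s))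
  · have := congrFun hf (K.planeCurve p s)
    simp only [Function.comp_apply, ContinuousMap.coe_mk, stereoInvFun_planeCurve hp] at this
    exact this

end Stereographic

/-- Each double point has exactly two parameters in a period. -/
lemma encard_fiber (hK : K.IsRegular) {v : S2} (hv : v ∈ K.doublePoints) :
    {s ∈ Ico (0 : ℝ) 1 | K.path s = v}.encard = 2 := by
  have h1 : {θ : UnitAddCircle | K.proj θ = v}.encard = 2 := by
    refine le_antisymm (hK.fiber_le_two v) ?_
    obtain ⟨θ, φ, hne, hθ, hφ⟩ := hv
    have : 1 < {θ : UnitAddCircle | K.proj θ = v}.encard := Set.one_lt_encard_iff.2 ⟨θ, φ, hθ, hφ, hne⟩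
    exact Order.add_one_le_of_lt this
  have hinj : InjOn (fun s : ℝ => (s : UnitAddCircle)) {s ∈ Ico (0 : ℝ) 1 | K.path s = v} := by
    intro s hs s' hs' h
    refine (AddCircle.coe_eq_coe_iff_of_mem_Ico (p := (1 : ℝ)) (a := 0) ?_ ?_).1 h
    · rw [zero_add]; exact hs.1
    · rw [zero_add]; exact hs'.1
  rw [← h1, ← hinj.encard_image]
  congr 1
  ext θ
  constructor
  · rintro ⟨s, hs, rfl⟩
    exact hs.2
  · intro h
    obtain ⟨s, rfl⟩ := QuotientAddGroup.mk_surjective θ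
    have h2 : ((Int.fract s : ℝ) : UnitAddCircle) = s :=
      coe_eq_coe_iff.2 ⟨⌊s⌋, (Int.fract_add_floor s).symm⟩
    refine ⟨Int.fract s, ⟨⟨Int.fract_nonneg s, Int.fract_lt_one s⟩, ?_⟩, h2⟩
    rw [path, h2]
    exact h

/-- The parameters of the double points in a period. There are twice as many of them as double
points. -/
lemma exists_finset_params (hK : K.IsRegular) {n : ℕ} (hcard : K.doublePoints.encard = n) :
    ∃ A : Finset ℝ, A.card = 2 * n ∧ ∀ s, s ∈ A ↔ s ∈ Ico (0 : ℝ) 1 ∧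
      K.path s ∈ K.doublePoints := by
  classical
  have hVf : K.doublePoints.Finite := Set.finite_of_encard_eq_coe hcard
  have hfib : ∀ v ∈ K.doublePoints, {s ∈ Ico (0 : ℝ) 1 | K.path s = v}.Finite := fun v hv =>
    Set.finite_of_encard_eq_coe (k := 2) (by rw [K.encard_fiber hK hv]; rfl)
  have hAf : {s ∈ Ico (0 : ℝ) 1 | K.path s ∈ K.doublePoints}.Finite := by
    refine (hVf.biUnion hfib).subset ?_
    rintro s ⟨hs, hsv⟩
    exact mem_biUnion hsv ⟨hs, rfl⟩
  have hmem : ∀ s, s ∈ hAf.toFinset ↔ s ∈ Ico (0 : ℝ) 1 ∧ K.path s ∈ K.doublePoints := by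
    intro s
    rw [Set.Finite.mem_toFinset]
    rfl
  refine ⟨hAf.toFinset, ?_, hmem⟩
  have hVcard : hVf.toFinset.card = n := by
    have := hVf.encard_eq_coe_toFinset_card
    rw [hcard] at this
    exact_mod_cast this.symm
  rw [Finset.card_eq_sum_card_fiberwise (f := K.path) (t := hVf.toFinset)
    (fun s hs => by
      rw [Set.Finite.coe_toFinset]
      exact ((hmem s).1 hs).2)]
  rw [Finset.sum_congr rfl (g := fun _ => 2), Finset.sum_const, hVcard, smul_eq_mul, mul_comm]
  intro v hv
  rw [Set.Finite.mem_toFinset] at hv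
  have h1 := K.encard_fiber hK hv
  have h2 : {s ∈ Ico (0 : ℝ) 1 | K.path s = v} =
      ((hAf.toFinset.filter (fun s => K.path s = v) : Finset ℝ) : Set ℝ) := by
    ext s
    rw [Finset.mem_coe, Finset.mem_filter, hmem]
    constructor
    · rintro ⟨h3, rfl⟩
      exact ⟨⟨h3, hv⟩, rfl⟩
    · rintro ⟨⟨h3, -⟩, h4⟩
      exact ⟨h3, h4⟩
  rw [h2, Set.encard_coe_eq_coe_finsetCard] at h1
  exact_mod_cast h1

/-- A regular knot projection is a closed curve with labelled transversal double points. -/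
lemma exists_crossingCurve (hK : K.IsRegular) {n : ℕ} (hn : 0 < n)
    (hcard : K.doublePoints.encard = n) :
    ∃ C : CrossingCurve S2 n, C.c = K.path ∧ C.V = K.doublePoints := by
  obtain ⟨p, hp⟩ := K.exists_notMem_diagram
  obtain ⟨A, hAcard, hA⟩ := K.exists_finset_params hK hcard
  obtain ⟨t, hmono, hadd, hrange⟩ := exists_strictMono_enumeration (fun a ha => ((hA a).1 ha).1)
    (by omega : 0 < 2 * n) hAcard
  have hfract : ∀ s, K.path (Int.fract s) = K.path s := by
    intro s
    rw [path, path, coe_eq_coe_iff.2 ⟨⌊s⌋, (Int.fract_add_floor s).symm⟩]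
  have ht : ∀ s, s ∈ range t ↔ K.path s ∈ K.doublePoints := by
    intro s
    rw [hrange, hA, hfract]
    exact and_iff_right ⟨Int.fract_nonneg s, Int.fract_lt_one s⟩
  have := finrank_E3
  have hP : finrank ℝ (ℝ ∙ (p : E3))ᗮ = 2 :=
    Submodule.finrank_orthogonal_span_singleton (norm_ne_zero_iff.1 (by rw [norm_coe]; simp))
  have hpath : K.path = fun u => stereoInvFun (norm_coe p) (K.planeCurve p u) :=
    funext fun u => (stereoInvFun_planeCurve hp u).symm
  have hper : ∀ s, K.planeCurve p (s + 1) = K.planeCurve p s := fun s =>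
    (planeCurve_eq_iff hp).2 (K.path_add_one s)
  have hsimple : ∀ s s', K.path s = K.path s' →
      (∃ k : ℤ, s' = s + k) ∨ (s ∈ range t ∧ s' ∈ range t) := by
    intro s s' h
    by_cases hc : (s : UnitAddCircle) = s'
    · exact Or.inl (coe_eq_coe_iff.1 hc)
    · right
      rw [ht, ht]
      exact ⟨K.path_mem_doublePoints_iff.2 ⟨s', hc, h⟩,
        K.path_mem_doublePoints_iff.2 ⟨s, Ne.symm hc, h.symm⟩⟩
  refine ⟨⟨K.path, t, K.continuous_path, K.path_add_one, hmono, ?_, hsimple, ?_, ?_, ?_⟩, rfl, ?_⟩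
  · exact_mod_cast hadd
  · intro k
    obtain ⟨s', hne, h⟩ := K.path_mem_doublePoints_iff.1 ((ht _).1 ⟨k, rfl⟩)
    obtain ⟨l, rfl⟩ := (ht s').2 (h ▸ (ht _).1 ⟨k, rfl⟩)
    exact ⟨l, h, fun j hj => hne (coe_eq_coe_iff.2 ⟨-j, by rw [hj]; push_cast; ring⟩)⟩
  · intro s hs O hO
    rw [hpath]
    refine exists_isArcChart isOpenEmbedding_stereoInvFun hP (contDiff_planeCurve hp) hper ?_ ?_
      (by rwa [stereoInvFun_planeCurve hp])
    · intro h0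
      refine hK.immersion s ?_
      rw [deriv_curve hp, h0, map_zero]
    · intro u hu
      rcases hsimple s u ((planeCurve_eq_iff hp).1 hu).symm with h | h
      · exact h
      · exact absurd h.1 hs
  · intro k l hkl hne O hO
    rw [hpath]
    have hne' : (t k : UnitAddCircle) ≠ t l := by
      intro h
      obtain ⟨j, hj⟩ := coe_eq_coe_iff.1 h
      exact hne (-j) (by rw [hj]; push_cast; ring)
    refine exists_isCrossChart isOpenEmbedding_stereoInvFun hP (contDiff_planeCurve hp) hper
      ((planeCurve_eq_iff hp).2 hkl) ?_ ?_ (by rwa [stereoInvFun_planeCurve hp])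
    · have h1 := hK.transversal (t k) (t l) hne' (congrArg Subtype.val hkl)
      rw [deriv_curve hp, deriv_curve hp, (planeCurve_eq_iff hp).2 hkl] at h1
      refine LinearIndependent.of_comp
        (fderiv ℝ (fun w : (ℝ ∙ (p : E3))ᗮ => stereoInvFunAux (p : E3) w)
          (K.planeCurve p (t l)) : (ℝ ∙ (p : E3))ᗮ →ₗ[ℝ] E3) ?_
      convert h1 using 1
      ext i
      fin_cases i <;> rfl
    · intro u hu
      have hu' := (planeCurve_eq_iff hp).1 hu
      by_contra! h
      have h1 : (u : UnitAddCircle) ≠ t k := fun h' => by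
        obtain ⟨j, hj⟩ := coe_eq_coe_iff.1 h'.symm
        exact h.1 j hj
      have h2 : (u : UnitAddCircle) ≠ t l := fun h' => by
        obtain ⟨j, hj⟩ := coe_eq_coe_iff.1 h'.symm
        exact h.2 j hj
      have h3 : ({(u : UnitAddCircle), (t k : UnitAddCircle), (t l : UnitAddCircle)} :
          Set UnitAddCircle).encard = 3 := Set.encard_eq_three.2 ⟨_, _, _, h1, h2, hne', rfl⟩
      have h4 : ({(u : UnitAddCircle), (t k : UnitAddCircle), (t l : UnitAddCircle)} :
          Set UnitAddCircle) ⊆ {θ | K.proj θ = K.path (t k)} := by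
        rintro θ (rfl | rfl | rfl)
        · exact hu'
        · rfl
        · exact hkl.symm
      have h5 := (Set.encard_le_encard h4).trans (hK.fiber_le_two _)
      rw [h3] at h5
      exact absurd h5 (by decide)
  · ext v
    constructor
    · rintro ⟨s, hs, rfl⟩
      exact (ht s).1 hs
    · intro hv
      obtain ⟨θ, φ, hne, rfl, hφ⟩ := id hv
      obtain ⟨s, rfl⟩ := QuotientAddGroup.mk_surjective θ
      exact ⟨s, (ht s).2 hv, rfl⟩

end SmoothKnot

end KnotProj

theorem mainTheorem7 (K : KnotProj.SmoothKnot) (hK : K.IsRegular) (n : ℕ) (hn : 0 < n)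
    (hcard : K.doublePoints.encard = n) :
    ∃ ρ : K.edges → K.edges → ℝ, IsGreatest K.edgeMetrics ρ ∧
      ∃ I J : K.edges, K.Neighbors I J ∧ 2 * (n : ℝ) / 3 ≤ ρ I J := by
  obtain ⟨C, hc, hV⟩ := K.exists_crossingCurve hK hn hcard
  obtain ⟨p, hp⟩ := K.exists_notMem_diagram
  have hD : K.diagram = Set.range C.c := by rw [hc, K.range_path]
  have hE : K.edges = Set.range C.edge := by
    rw [← C.setOf_closure_connectedComponentIn, KnotProj.SmoothKnot.edges, hD, hV]
  have hidx : ∀ I : K.edges, ∃ i : ℤ, C.edge i = I := by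
    rintro ⟨I, hI⟩
    rw [hE] at hI
    exact hI
  choose idx hidx using hidx
  let ed : ℤ → K.edges := fun i => ⟨C.edge i, by rw [hE]; exact ⟨i, rfl⟩⟩
  have hne : (1 : ZMod (2 * n)) ≠ 0 := by
    have : Fact (1 < 2 * n) := ⟨by omega⟩
    exact one_ne_zero
  have hsucc : ∀ (I J : K.edges), ((idx J : ℤ) : ZMod (2 * n)) = idx I + 1 →
      (I : Set KnotProj.S2) ≠ J ∧
        ∃ a b : ℝ, a ≤ b ∧ (I : Set KnotProj.S2) ∪ J = C.c '' Set.Icc a b := by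
    intro I J h
    have h1 : C.edge (idx I + 1) = J := by
      rw [← hidx J, C.edge_eq_iff, h]
      push_cast
      rfl
    refine ⟨fun h2 => hne ?_, C.t (idx I), C.t (idx I + 1 + 1), (C.mono (by omega)).le, ?_⟩
    · rw [← hidx I, ← hidx J, C.edge_eq_iff, h] at h2
      simpa using h2
    · rw [← C.edge_union_edge_succ, hidx, h1]
  refine ⟨_, KnotProj.isGreatest_natAbs_valMinAbs (by omega : 2 ≤ 2 * n)
    (fun I => ((idx I : ℤ) : ZMod (2 * n))) ⟨fun I J h => ?_, fun z => ?_⟩ K.Consecutive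
    fun I J => ⟨fun h => ?_, fun h => ?_⟩, ?_⟩
  · rw [← C.edge_eq_iff, hidx, hidx] at h
    exact Subtype.ext h
  · obtain ⟨i, rfl⟩ := ZMod.intCast_surjective z
    refine ⟨ed i, ?_⟩
    rw [← C.edge_eq_iff, hidx]
  · obtain ⟨hIJ, a, b, -, hab⟩ := h
    refine C.index_succ_of_union_eq_image (a := a) (b := b) ?_ ?_
    · rw [hidx, hidx]
      exact fun h => hIJ (Subtype.ext h)
    · rw [hidx, hidx, hab, hc]
      rfl
  · rcases h with h | h
    · obtain ⟨h1, a, b, hab, h2⟩ := hsucc I J h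
      refine ⟨fun h => h1 (congrArg _ h), a, b, hab, ?_⟩
      rw [h2, hc]
      rfl
    · obtain ⟨h1, a, b, hab, h2⟩ := hsucc J I h
      refine ⟨fun h => h1 (congrArg _ h.symm), a, b, hab, ?_⟩
      rw [Set.union_comm, h2, hc]
      rfl
  · have := KnotProj.locallyConnectedSpace_S2
    have := KnotProj.preconnectedSpace_S2
    obtain ⟨x, hx, i, j, hi, hj, hij⟩ := C.exists_not_close hn (by
      rw [hc]
      exact KnotProj.SmoothKnot.exists_continuous_log hp)
    rw [KnotProj.CrossingCurve.Bd, KnotProj.CrossingCurve.face, ← hD] at hi hj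
    rw [← hD] at hx
    refine ⟨ed i, ed j, ⟨x, hx, hi, hj⟩, ?_⟩
    have h := KnotProj.le_natAbs_valMinAbs_of_not_close hij
    have hi' : ((idx (ed i) : ℤ) : ZMod (2 * n)) = i := by rw [← C.edge_eq_iff, hidx]
    have hj' : ((idx (ed j) : ℤ) : ZMod (2 * n)) = j := by rw [← C.edge_eq_iff, hidx]
    simp only [hi', hj']
    exact h
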